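/- Let $G$ be a Lie group with Lie algebra $\mathfrak g=T_1G$ and let $k\ge 0$. Let $J^kG$ be the group of $k$-jets $j^kc$ at $0$ of smooth curves $c:\mathbb R\to G$, with product $(j^kc)(j^kb)=j^k(cb)$. Let $\delta^rc=c'c^{-1}:\mathbb R\to\mathfrak g$ denote the right logarithmic derivative of $c$. Identify $J^kG$ with $G\times\mathfrak g^k$ by the right trivialization, i.e. by the (well-defined) bijection $$j^kc\mapsto\big(c(0),(\delta^rc)(0),(\delta^rc)'(0),\dots,(\delta^rc)^{(k-1)}(0)\big).$$ For $n\ge 1$ let $\mathcal P_n$ be the set of partitions $\lambda=\lambda_1|\cdots|\lambda_\ell$ of $\{1,\dots,n\}$ into nonempty blocks, ordered anti-lexicographically (from right to left one always takes the block that contains the highest available number, i.e. $\max\lambda_1<\cdots<\max\lambda_\ell$). Write $\ell=\ell(\lambda)$ and $i_r=|\lambda_r|$. For positive integers $i_1,\dots,i_\ell$ put $$N_{(i_1,\dots,i_\ell)}=\binom{i_1+\dots+i_\ell-1}{i_\ell-1}\binom{i_1+\dots+i_{\ell-1}-1}{i_{\ell-1}-1}\cdots\binom{i_1+i_2-1}{i_2-1}.$$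 Then for all $g,h\in G$ and $x_1,\dots,x_k,y_1,\dots,y_k\in\mathfrak g$ the product in $J^kG$ is $(g,x_1,\dots,x_k)(h,y_1,\dots,y_k)=(gh,z_1,\dots,z_k)$, where for $1\le n\le k$ $$z_n=x_n+\sum_{\lambda\in\mathcal P_n}\mathrm{ad}_{x_{i_{\ell-1}}}\cdots\mathrm{ad}_{x_{i_1}}\mathrm{Ad}_g\,y_{i_\ell} =x_n+\sum_{\ell=1}^n\ \sum_{i_1+\dots+i_\ell=n}N_{(i_1,\dots,i_\ell)}\,\mathrm{ad}_{x_{i_{\ell-1}}}\cdots\mathrm{ad}_{x_{i_1}}\mathrm{Ad}_g\,y_{i_\ell},$$ and the inverse is $(g,x_1,\dots,x_k)^{-1}=(g^{-1},w_1,\dots,w_k)$, where for $1\le n\le k$ $$w_n=\sum_{\lambda\in\mathcal P_n}(-1)^\ell\,\mathrm{Ad}_{g^{-1}}\mathrm{ad}_{x_{i_1}}\cdots\mathrm{ad}_{x_{i_{\ell-1}}}x_{i_\ell} =\sum_{\ell=1}^n\ \sum_{i_1+\dots+i_\ell=n}(-1)^\ell N_{(i_1,\dots,i_\ell)}\,\mathrm{Ad}_{g^{-1}}\mathrm{ad}_{x_{i_1}}\cdots\mathrm{ad}_{x_{i_{\ell-1}}}x_{i_\ell}.$$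 The inner sums run over all $\ell$-tuples $(i_1,\dots,i_\ell)$ of positive integers with sum $n$. -/

import Mathlib

open scoped Manifold ContDiff

namespace JetGroup

section Aux

variable {E F : Type*} [NormedAddCommGroup E] [NormedSpace ℝ E]
  [NormedAddCommGroup F] [NormedSpace ℝ F]

/-- The derivatives up to order `k` of a composite only depend on the derivatives up to order `k`
of the inner curve. -/
theorem iteratedFDeriv_comp_congr {φ : E → F} {u v : ℝ → E} {k : ℕ}
    (hφ : ContDiffAt ℝ ∞ φ (u 0)) (hu : ContDiffAt ℝ ∞ u 0) (hv : ContDiffAt ℝ ∞ v 0)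
    (h : ∀ n ≤ k, iteratedFDeriv ℝ n u 0 = iteratedFDeriv ℝ n v 0) :
    ∀ n ≤ k, iteratedFDeriv ℝ n (φ ∘ u) 0 = iteratedFDeriv ℝ n (φ ∘ v) 0 := by
  intro n hn
  have h0 : u 0 = v 0 := by
    have := congrArg (fun m => m 0) (h 0 (Nat.zero_le _))
    simpa using this
  have hni : (n : WithTop ℕ∞) ≤ ∞ := by exact_mod_cast le_top
  have hφ' : ContDiffAt ℝ ∞ φ (v 0) := h0 ▸ hφ
  rw [iteratedFDeriv_comp hφ hu hni, iteratedFDeriv_comp hφ' hv hni, h0]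
  unfold FormalMultilinearSeries.taylorComp
  refine Finset.sum_congr rfl fun c _ => ?_
  unfold FormalMultilinearSeries.compAlongOrderedFinpartition
  congr 1
  funext m
  exact h _ ((c.partSize_le m).trans hn)

theorem iteratedDeriv_eq_iff_iteratedFDeriv_eq {u v : ℝ → E} {n : ℕ} :
    iteratedDeriv n u 0 = iteratedDeriv n v 0 ↔
      iteratedFDeriv ℝ n u 0 = iteratedFDeriv ℝ n v 0 := by
  constructor
  · intro h
    rw [iteratedFDeriv_eq_equiv_comp, iteratedFDeriv_eq_equiv_comp, Function.comp_apply,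
      Function.comp_apply, h]
  · intro h
    rw [iteratedDeriv, iteratedDeriv, h]

end Aux

noncomputable section

variable {E : Type*} [NormedAddCommGroup E] [NormedSpace ℝ E]
  {H : Type*} [TopologicalSpace H] (I : ModelWithCorners ℝ E H)
  (G : Type*) [TopologicalSpace G] [ChartedSpace H G]

/-- Smooth curves `ℝ → G`. -/
abbrev Curve : Type _ := C^∞⟮𝓘(ℝ, ℝ), ℝ; I, G⟯

variable {I G}

/-- Two curves have the same `k`-jet at `0`: they pass through the same point at time `0`, and in
the chart around that point their derivatives at `0` up to order `k` coincide. -/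
def SameJet (k : ℕ) (c b : Curve I G) : Prop :=
  c 0 = b 0 ∧ ∀ n ≤ k,
    iteratedDeriv n (extChartAt I (c 0) ∘ c) 0 = iteratedDeriv n (extChartAt I (c 0) ∘ b) 0

theorem contDiffAt_chart_comp {c : Curve I G} {g : G} (h : c 0 = g) :
    ContDiffAt ℝ ∞ (extChartAt I g ∘ c) 0 := by
  have h1 : ContMDiffAt 𝓘(ℝ, ℝ) I ∞ c 0 := c.contMDiff.contMDiffAt
  rw [contMDiffAt_iff] at h1
  subst h
  have h2 := h1.2
  rw [ModelWithCorners.range_eq_univ, contDiffWithinAt_univ] at h2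
  exact h2

theorem SameJet.mul [I.Boundaryless] [Group G] [LieGroup I ∞ G] {k : ℕ} {c c' b b' : Curve I G}
    (hc : SameJet k c c') (hb : SameJet k b b') : SameJet k (c * b) (c' * b') := by
  obtain ⟨hc0, hc⟩ := hc
  obtain ⟨hb0, hb⟩ := hb
  refine ⟨by simp [hc0, hb0], ?_⟩
  set g := c 0 with hg
  set h := b 0 with hh
  have e0 : (c * b) 0 = g * h := rfl
  rw [e0]
  -- the multiplication read in charts
  let φ : E × E → E := fun p =>
    extChartAt I (g * h) ((extChartAt I g).symm p.1 * (extChartAt I h).symm p.2)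
  have hφ : ContDiffAt ℝ ∞ φ (extChartAt I g g, extChartAt I h h) := by
    have hm : ContMDiffAt (I.prod I) I ∞ (fun p : G × G => p.1 * p.2) (g, h) :=
      (contMDiff_mul I ∞).contMDiffAt
    rw [contMDiffAt_iff] at hm
    have h2 := hm.2
    rw [ModelWithCorners.range_eq_univ, contDiffWithinAt_univ] at h2
    exact h2
  have key : ∀ c₁ b₁ : Curve I G, c₁ 0 = g → b₁ 0 = h →
      (extChartAt I (g * h) ∘ (c₁ * b₁ : Curve I G)) =ᶠ[nhds 0]
        φ ∘ fun t => ((extChartAt I g ∘ c₁) t, (extChartAt I h ∘ b₁) t) := by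
    intro c₁ b₁ h1 h2
    have s1 : ∀ᶠ t in nhds (0 : ℝ), c₁ t ∈ (extChartAt I g).source :=
      c₁.contMDiff.continuous.continuousAt.eventually
        (by rw [h1]; exact extChartAt_source_mem_nhds g)
    have s2 : ∀ᶠ t in nhds (0 : ℝ), b₁ t ∈ (extChartAt I h).source :=
      b₁.contMDiff.continuous.continuousAt.eventually
        (by rw [h2]; exact extChartAt_source_mem_nhds h)
    filter_upwards [s1, s2] with t t1 t2
    change extChartAt I (g * h) (c₁ t * b₁ t) = extChartAt I (g * h)
      ((extChartAt I g).symm (extChartAt I g (c₁ t)) *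
        (extChartAt I h).symm (extChartAt I h (b₁ t)))
    rw [(extChartAt I g).left_inv t1, (extChartAt I h).left_inv t2]
  intro n hn
  rw [Filter.EventuallyEq.iteratedDeriv_eq n (key c b rfl rfl),
    Filter.EventuallyEq.iteratedDeriv_eq n (key c' b' hc0.symm hb0.symm),
    iteratedDeriv_eq_iff_iteratedFDeriv_eq]
  have dc := contDiffAt_chart_comp (c := c) (g := g) rfl
  have db := contDiffAt_chart_comp (c := b) (g := h) rfl
  have dc' := contDiffAt_chart_comp (c := c') (g := g) hc0.symm
  have db' := contDiffAt_chart_comp (c := b') (g := h) hb0.symm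
  refine iteratedFDeriv_comp_congr (k := k) hφ (dc.prodMk db) (dc'.prodMk db') ?_ n hn
  intro m hm
  have hmi : (m : WithTop ℕ∞) ≤ ∞ := by exact_mod_cast le_top
  rw [iteratedFDeriv_prodMk dc db hmi, iteratedFDeriv_prodMk dc' db' hmi,
    iteratedDeriv_eq_iff_iteratedFDeriv_eq.1 (hc m hm),
    iteratedDeriv_eq_iff_iteratedFDeriv_eq.1 (hb m hm)]

section Group

variable [I.Boundaryless] [Group G] [LieGroup I ∞ G]

variable (I G) in
/-- Having the same `k`-jet at `0`, as a congruence on the group of smooth curves in `G` under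
pointwise multiplication. -/
def jetCon (k : ℕ) : Con (Curve I G) where
  r := SameJet k
  iseqv :=
    { refl := fun _ => ⟨rfl, fun _ _ => rfl⟩
      symm := fun {a b} h => ⟨h.1.symm, fun n hn => by rw [← h.1]; exact (h.2 n hn).symm⟩
      trans := fun {a b c} h h' => ⟨h.1.trans h'.1, fun n hn =>
        (h.2 n hn).trans (by rw [h.1]; exact h'.2 n hn)⟩ }
  mul' := SameJet.mul

variable (I G) in
/-- The jet group `J^k G` of `k`-jets at `0` of smooth curves in the Lie group `G`. -/
abbrev Jet (k : ℕ) : Type _ := (jetCon I G k).Quotient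

/-- The `k`-jet at `0` of a curve. The group structure of `J^k G` satisfies
`jet k c * jet k b = jet k (c * b)` and `(jet k c)⁻¹ = jet k c⁻¹`. -/
def jet (k : ℕ) (c : Curve I G) : Jet I G k := (c : (jetCon I G k).Quotient)

theorem jet_mul (k : ℕ) (c b : Curve I G) : jet k c * jet k b = jet k (c * b) := rfl

theorem jet_inv (k : ℕ) (c : Curve I G) : (jet k c)⁻¹ = jet k c⁻¹ := rfl

theorem jet_eq_iff (k : ℕ) (c b : Curve I G) : jet k c = jet k b ↔ SameJet k c b :=
  (jetCon I G k).eq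

end Group

variable [Group G]

/-- The right logarithmic derivative `δʳc(t) = c'(t) c(t)⁻¹`, i.e. the image of the velocity
`c'(t)` under the tangent map of the right translation by `c(t)⁻¹`. -/
def rightLogDeriv (c : Curve I G) (t : ℝ) : GroupLieAlgebra I G :=
  mfderiv I I (fun h : G => h * (c t)⁻¹) (c t) (mfderiv 𝓘(ℝ, ℝ) I c t (1 : ℝ))

/-- The expression `(c(0), (δʳc)(0), (δʳc)'(0), …, (δʳc)^(k-1)(0))` of a curve; the components in
the Lie algebra are indexed by `1, …, k`. -/
def rightCoords (k : ℕ) (c : Curve I G) : G × (Finset.Icc 1 k → GroupLieAlgebra I G) :=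
  (c 0, fun n => iteratedDeriv (F := E) ((n : ℕ) - 1) (rightLogDeriv c) 0)

/-- The adjoint action `Ad_g` on the Lie algebra: the tangent map at `1` of `h ↦ g h g⁻¹`. -/
def Ad (g : G) (v : GroupLieAlgebra I G) : GroupLieAlgebra I G :=
  mfderiv I I (fun h : G => g * h * g⁻¹) (1 : G) v

/-- The entry `x_j` of `(x_1, …, x_k)`, with the convention `x_j = 0` for `j ∉ {1, …, k}`. -/
def entry {k : ℕ} (x : Finset.Icc 1 k → GroupLieAlgebra I G) (j : ℕ) : GroupLieAlgebra I G :=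
  if h : j ∈ Finset.Icc 1 k then x ⟨j, h⟩ else 0

/-- `ad_{x_{i_{ℓ-1}}} ⋯ ad_{x_{i_1}} Ad_g y_{i_ℓ}` for the list `i = [i_1, …, i_ℓ]`, `ℓ ≥ 1`. -/
def mulTerm {k : ℕ} (g : G) (x y : Finset.Icc 1 k → GroupLieAlgebra I G) (i : List ℕ) :
    GroupLieAlgebra I G :=
  i.dropLast.foldl (fun v j => ⁅entry x j, v⁆) (Ad g (entry y (i.getLastD 0)))

/-- `Ad_{g⁻¹} ad_{x_{i_1}} ⋯ ad_{x_{i_{ℓ-1}}} x_{i_ℓ}` for the list `i = [i_1, …, i_ℓ]`,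
`ℓ ≥ 1`. -/
def invTerm {k : ℕ} (g : G) (x : Finset.Icc 1 k → GroupLieAlgebra I G) (i : List ℕ) :
    GroupLieAlgebra I G :=
  Ad g⁻¹ (i.dropLast.foldr (fun j v => ⁅entry x j, v⁆) (entry x (i.getLastD 0)))

/-- The cardinalities `[i_1, …, i_ℓ]` of the blocks of a partition `λ_1 | ⋯ | λ_ℓ` of an
`n`-element ordered set. The type `OrderedFinpartition n` consists of the partitions of `Fin n`
into nonempty blocks, listed by increasing greatest element; this is the anti-lexicographic
ordering, where from right to left one always takes the block which contains the highest available
number. -/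
def blockSizes {n : ℕ} (p : OrderedFinpartition n) : List ℕ := List.ofFn p.partSize

/-- `N_{(i_1, …, i_ℓ)} = ∏_r (i_1 + ⋯ + i_r - 1 choose i_r - 1)`. The factor for `r = 1` is
`1`. -/
def N {n : ℕ} (i : Composition n) : ℕ :=
  ∏ r : Fin i.length, (i.sizeUpTo (r + 1) - 1).choose (i.blocksFun r - 1)

end

end JetGroup

namespace JetGroup

/-! ### Block sizes of ordered partitions and their number -/

section Combinatorics

/-! Everything comes from differentiating two identities for the right logarithmic derivative,
δʳ(cb) = δʳc + Ad_c δʳb and δʳ(c⁻¹) = -Ad_{c⁻¹} δʳc, with the rules (Ad_c v)' = ad_{δʳc} Ad_c v +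
Ad_c v' and (Ad_{c⁻¹} v)' = Ad_{c⁻¹}(v' - ad_{δʳc} v). A summand is labelled by the list [i_1, …,
i_ℓ] of its derivative orders plus one. Differentiating the factor Ad creates a new ad_{δʳc} right
next to it and prepends 1 to the list; differentiating any other factor raises one i_r by 1. These
are precisely the ways to add a new least element to a partition ordered by block maxima: as a
singleton, which comes first, or inside an existing block, which leaves the order of the maxima
intact. Induction (`iteratedDeriv_eq_sum_blockSizes`) turns the derivative of order n-1 into a sum
over the partitions of an n-element set.

The second form of each formula groups partitions by block sizes. That N counts them follows by
removing the least element again: N satisfies the resulting recursion by Pascal's rule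
(`weight_eq_sumErase`, `card_blockSizes_eq`).

For the trivialization, right translation moves curves to 1, where δʳc = A(u)u' for the curve u in
the chart, with A = id at the base point. Hence the n-th derivative of δʳc is the (n+1)-st
derivative of u plus terms depending only on lower ones. Order by order this gives injectivity
(`iteratedDeriv_eq_iff_logDeriv`) and surjectivity (`exists_logDeriv_eq`, then a cutoff).

The bracket is defined through left-invariant fields, so it must also be shown to be the derivative
of Ad at 1 (`bracket_eq`); this rests on the symmetry of the second derivative of multiplication in
the chart. -/

theorem blockSizes_length {n : ℕ} (p : OrderedFinpartition n) :
    (blockSizes p).length = p.length := by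
  simp [blockSizes]

theorem blockSizes_pos {n : ℕ} (p : OrderedFinpartition n) {j : ℕ} (hj : j ∈ blockSizes p) :
    0 < j := by
  obtain ⟨m, rfl⟩ := (List.mem_ofFn' _ _).1 hj
  exact p.partSize_pos m

theorem blockSizes_le {n : ℕ} (p : OrderedFinpartition n) {j : ℕ} (hj : j ∈ blockSizes p) :
    j ≤ n := by
  obtain ⟨m, rfl⟩ := (List.mem_ofFn' _ _).1 hj
  exact p.partSize_le m

theorem blockSizes_sum {n : ℕ} (p : OrderedFinpartition n) : (blockSizes p).sum = n := by
  have h := Fintype.card_congr p.equivSigma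
  simpa [blockSizes, List.sum_ofFn] using h

theorem blockSizes_extendLeft {n : ℕ} (p : OrderedFinpartition n) :
    blockSizes p.extendLeft = 1 :: blockSizes p := by
  simp only [blockSizes]
  exact List.ofFn_cons 1 p.partSize

theorem blockSizes_extendMiddle {n : ℕ} (p : OrderedFinpartition n) (r : Fin p.length) :
    blockSizes (p.extendMiddle r) = (blockSizes p).modify r (· + 1) := by
  change List.ofFn (Function.update p.partSize r (p.partSize r + 1)) = _
  refine List.ext_getElem (by simp [blockSizes]) fun i h₁ h₂ => ?_
  simp only [blockSizes, List.getElem_ofFn, List.getElem_modify, Function.update_apply,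
    Fin.ext_iff]
  by_cases h : i = r
  · subst h
    simp
  · simp [h, Ne.symm h]

/-- The sum of `f` over the block sizes obtained from those in `L` by adding a new least element to
the partitioned set: either as a singleton block or in one of the given blocks. -/
def sumExtend {M : Type*} [AddCommMonoid M] (f : List ℕ → M) (L : List ℕ) : M :=
  f (1 :: L) + ∑ r ∈ Finset.range L.length, f (L.modify r (· + 1))

/-- Deleting the least element maps partitions of n + 1 elements to partitions of n elements; the
fibre over `p` consists of the singleton extension and one extension for each block of `p`. -/
theorem sum_blockSizes_succ {M : Type*} [AddCommMonoid M] (f : List ℕ → M) (n : ℕ) :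
    ∑ p : OrderedFinpartition (n + 1), f (blockSizes p) =
      ∑ p : OrderedFinpartition n, sumExtend f (blockSizes p) := by
  rw [← (OrderedFinpartition.extendEquiv n).sum_comp, Fintype.sum_sigma]
  refine Finset.sum_congr rfl fun p _ => ?_
  rw [Fintype.sum_option]
  simp only [OrderedFinpartition.extendEquiv, Equiv.coe_fn_mk, OrderedFinpartition.extend_none,
    OrderedFinpartition.extend_some, blockSizes_extendLeft, blockSizes_extendMiddle, sumExtend,
    blockSizes_length]
  rw [Finset.sum_range fun r => f ((blockSizes p).modify r (· + 1))]

/-- The product of binomial coefficients counting the partitions with given block sizes, listed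
from right to left. -/
def revWeight : List ℕ → ℕ
  | [] => 1
  | a :: R => (R.sum + a - 1).choose (a - 1) * revWeight R

/-- The number of ordered partitions with block sizes `L`. -/
def weight (L : List ℕ) : ℕ := revWeight L.reverse

theorem weight_append (L : List ℕ) (a : ℕ) :
    weight (L ++ [a]) = (L.sum + a - 1).choose (a - 1) * weight L := by
  simp [weight, revWeight]

theorem weight_nil : weight [] = 1 := rfl

theorem weight_eq_prod (L : List ℕ) :
    weight L = ∏ r : Fin L.length, ((L.take (r + 1)).sum - 1).choose (L[r] - 1) := by
  induction L using List.reverseRecOn with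
  | nil => simp [weight_nil]
  | append_singleton L a ih =>
    rw [weight_append, ih]
    have e : (L ++ [a]).length = L.length + 1 := by simp
    rw [← (finCongr e.symm).prod_comp, Fin.prod_univ_castSucc, mul_comm]
    congr 1
    · refine Finset.prod_congr rfl fun r _ => ?_
      have hr : (r : ℕ) + 1 - L.length = 0 := by omega
      simp [List.take_append, hr]
    · simp [List.take_of_length_le]

theorem N_eq_weight {n : ℕ} (i : Composition n) : N i = weight i.blocks := by
  rw [weight_eq_prod]
  rfl

theorem sum_modify_pred {L : List ℕ} {r : ℕ} (hr : r < L.length) (h : 1 ≤ L[r]) :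
    (L.modify r (· - 1)).sum = L.sum - 1 := by
  induction L generalizing r with
  | nil => simp at hr
  | cons a L ih =>
    cases r with
    | zero => simp at h ⊢; omega
    | succ r =>
      simp only [List.length_cons, Nat.add_lt_add_iff_right, List.getElem_cons_succ] at hr h
      have : L[r] ≤ L.sum := List.single_le_sum (by simp) _ (List.getElem_mem hr)
      simp only [List.modify_succ_cons, List.sum_cons, ih hr h]
      omega

/-- The sum of `f` over the block sizes obtained from those in `L` by removing the least element of
the partitioned set. -/
def sumErase (f : List ℕ → ℕ) (L : List ℕ) : ℕ :=
  (if L.head? = some 1 then f L.tail else 0) +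
    ∑ r ∈ Finset.range L.length, if 2 ≤ L.getD r 0 then f (L.modify r (· - 1)) else 0

/-- Split off the last block, of size a, and let s be the sum of the others. Erasing from the other
blocks gives, by induction, C(s+a-2, a-1) times their weight, and erasing from the last block gives
C(s+a-2, a-2) times it; Pascal's rule adds these up. For a = 1 the second contribution is absent and
the binomials are 1. -/
theorem weight_eq_sumErase {L : List ℕ} (hL : L ≠ []) (hpos : ∀ j ∈ L, 0 < j) :
    weight L = sumErase weight L := by
  induction L using List.reverseRecOn with
  | nil => exact absurd rfl hL
  | append_singleton T a ih =>
    have ha : 0 < a := hpos a (by simp)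
    have hT : ∀ j ∈ T, 0 < j := fun j hj => hpos j (by simp [hj])
    rcases eq_or_ne T [] with rfl | hne
    · obtain rfl | ha2 : a = 1 ∨ 2 ≤ a := by omega
      · simp [sumErase, weight, revWeight]
      · have : a ≠ 1 := by omega
        simp [sumErase, weight, revWeight, this, ha2]
    · have hs : 0 < T.sum := by
        obtain ⟨b, T', rfl⟩ := List.exists_cons_of_ne_nil hne
        have := hT b (by simp)
        simp only [List.sum_cons]
        omega
      have e1 : (if (T ++ [a]).head? = some 1 then weight (T ++ [a]).tail else 0) =
          (T.sum - 1 + a - 1).choose (a - 1) *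
            (if T.head? = some 1 then weight T.tail else 0) := by
        obtain ⟨b, T', rfl⟩ := List.exists_cons_of_ne_nil hne
        by_cases hb : b = 1
        · subst hb
          simp [weight_append]
        · simp [hb]
      have e2 : ∀ r ∈ Finset.range T.length,
          (if 2 ≤ (T ++ [a]).getD r 0 then weight ((T ++ [a]).modify r (· - 1)) else 0) =
          (T.sum - 1 + a - 1).choose (a - 1) *
            (if 2 ≤ T.getD r 0 then weight (T.modify r (· - 1)) else 0) := by
        intro r hr
        have hr' : r < T.length := Finset.mem_range.1 hr
        have e3 : (T ++ [a]).getD r 0 = T[r] := by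
          simp [List.getD_eq_getElem?_getD, List.getElem?_append_left hr', hr']
        have e4 : T.getD r 0 = T[r] := by simp [List.getD_eq_getElem?_getD, hr']
        have e5 : (T ++ [a]).modify r (· - 1) = T.modify r (· - 1) ++ [a] := by
          rw [List.modify_eq_set_getElem?, List.modify_eq_set_getElem?]
          simp [List.getElem?_append_left hr', hr']
        rw [e3, e4, e5]
        split_ifs with h2
        · rw [weight_append, sum_modify_pred hr' (by omega)]
        · simp
      have e6 : (if 2 ≤ (T ++ [a]).getD T.length 0 then
          weight ((T ++ [a]).modify T.length (· - 1)) else 0) =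
          if 2 ≤ a then (T.sum + a - 2).choose (a - 2) * weight T else 0 := by
        have e7 : (T ++ [a]).modify T.length (· - 1) = T ++ [a - 1] := by
          rw [List.modify_eq_set_getElem?]
          simp
        rw [e7, weight_append]
        simp [List.getD_eq_getElem?_getD, show T.sum + (a - 1) - 1 = T.sum + a - 2 by omega,
          Nat.sub_sub]
      have e8 : T.sum - 1 + a - 1 = T.sum + a - 2 := by omega
      rw [sumErase, e1, List.length_append, List.length_singleton, Finset.sum_range_succ,
        Finset.sum_congr rfl e2, e6, ← Finset.mul_sum, ← add_assoc, ← mul_add,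
        ← sumErase, ← ih hne hT, weight_append, e8]
      split_ifs with h2
      · obtain ⟨b, rfl⟩ : ∃ b, a = b + 2 := ⟨a - 2, by omega⟩
        rw [← add_mul]
        congr 1
        have : T.sum + (b + 2) - 1 = (T.sum + b) + 1 := by omega
        rw [this, show b + 2 - 1 = b + 1 by omega, Nat.choose_succ_succ, add_comm]
        congr 1
      · obtain rfl : a = 1 := by omega
        simp

/-- Inserting an element into block r is undone by removing one; the bound 2 records that the block
was nonempty before the insertion. -/
theorem modify_succ_eq_iff {M L : List ℕ} (hM : ∀ j ∈ M, 0 < j) {r : ℕ} :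
    (r < M.length ∧ M.modify r (· + 1) = L) ↔
      r < L.length ∧ 2 ≤ L.getD r 0 ∧ M = L.modify r (· - 1) := by
  constructor
  · rintro ⟨hr, rfl⟩
    have := hM _ (List.getElem_mem hr)
    refine ⟨by simpa using hr, ?_, ?_⟩
    · simp [List.getD_eq_getElem?_getD, hr]; omega
    · refine List.ext_getElem (by simp) fun i h₁ h₂ => ?_
      simp only [List.getElem_modify]
      split_ifs <;> simp
  · rintro ⟨hr, h2, rfl⟩
    refine ⟨by simpa using hr, ?_⟩
    simp only [List.getD_eq_getElem?_getD, hr, getElem?_pos, Option.getD_some] at h2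
    refine List.ext_getElem (by simp) fun i h₁ h₂ => ?_
    simp only [List.getElem_modify]
    split_ifs with h
    · subst h; omega
    · rfl

/-- Both sides obey the same recursion under removal of the least element. The count is a sum of
indicators so that `sum_blockSizes_succ` applies to it. -/
theorem card_blockSizes_eq {n : ℕ} {L : List ℕ} (hpos : ∀ j ∈ L, 0 < j) (hsum : L.sum = n) :
    (∑ p : OrderedFinpartition n, if blockSizes p = L then 1 else 0) = weight L := by
  induction n generalizing L with
  | zero =>
    have : L = [] := by
      rcases L with _ | ⟨a, L⟩
      · rfl
      · have := hpos a (by simp)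
        simp only [List.sum_cons] at hsum
        omega
    subst this
    rw [Fintype.sum_unique, if_pos, weight_nil]
    exact List.eq_nil_of_length_eq_zero (by simp [blockSizes_length, default])
  | succ n ih =>
    have hne : L ≠ [] := by rintro rfl; simp at hsum
    rw [sum_blockSizes_succ fun M => if M = L then 1 else 0, weight_eq_sumErase hne hpos]
    simp only [sumExtend, sumErase]
    rw [Finset.sum_add_distrib]
    congr 1
    · obtain ⟨b, T, rfl⟩ := List.exists_cons_of_ne_nil hne
      by_cases hb : b = 1
      · subst hb
        simp only [List.cons.injEq, true_and, List.head?_cons, ↓reduceIte, List.tail_cons]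
        exact ih (fun j hj => hpos j (by simp [hj])) (by simp at hsum; omega)
      · simp [hb, Ne.symm hb]
    · have e : ∀ p : OrderedFinpartition n, ∑ r ∈ Finset.range (blockSizes p).length,
          (if (blockSizes p).modify r (· + 1) = L then 1 else 0) =
          ∑ r ∈ Finset.range L.length, if 2 ≤ L.getD r 0 then
            (if blockSizes p = L.modify r (· - 1) then 1 else 0) else 0 := by
        intro p
        simp only [← ite_and]
        rw [← Finset.sum_filter, ← Finset.sum_filter]
        congr 1
        ext r
        simp only [Finset.mem_filter, Finset.mem_range]
        exact modify_succ_eq_iff fun j hj => blockSizes_pos p hj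
      rw [Finset.sum_congr rfl fun p _ => e p, Finset.sum_comm]
      refine Finset.sum_congr rfl fun r hr => ?_
      split_ifs with h2
      · have hr' := Finset.mem_range.1 hr
        simp only [List.getD_eq_getElem?_getD, hr', getElem?_pos, Option.getD_some] at h2
        refine ih (fun j hj => ?_) ?_
        · obtain ⟨i, hi, rfl⟩ := List.getElem_of_mem hj
          simp only [List.getElem_modify]
          split_ifs with h
          · subst h; omega
          · exact hpos _ (List.getElem_mem _)
        · rw [sum_modify_pred hr' (by omega)]
          omega
      · simp

/-- The composition of `n` given by the block sizes of a partition. -/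
def toComposition {n : ℕ} (p : OrderedFinpartition n) : Composition n where
  blocks := blockSizes p
  blocks_pos := blockSizes_pos p
  blocks_sum := blockSizes_sum p

/-- Partitions are grouped by their composition of block sizes, and the fibre over `i` has `N i`
elements. Since 1 ≤ n, no composition has length 0. -/
theorem sum_blockSizes_eq_sum_composition {M : Type*} [AddCommMonoid M] (f : List ℕ → M)
    {n : ℕ} (hn : 1 ≤ n) :
    ∑ p : OrderedFinpartition n, f (blockSizes p) =
      ∑ l ∈ Finset.Icc 1 n, ∑ i : Composition n with i.length = l, N i • f i.blocks := by
  rw [Finset.sum_fiberwise_of_maps_to (g := fun i : Composition n => i.length)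
    fun i _ => Finset.mem_Icc.2 ⟨i.length_pos_of_pos hn, i.length_le⟩,
    ← Finset.sum_fiberwise Finset.univ (toComposition (n := n))]
  refine Finset.sum_congr rfl fun i _ => ?_
  have : ∀ p ∈ Finset.univ.filter (fun p => toComposition (n := n) p = i),
      f (blockSizes p) = f i.blocks := by
    intro p hp
    rw [← (Finset.mem_filter.1 hp).2]
    rfl
  rw [Finset.sum_congr rfl this, Finset.sum_const, N_eq_weight,
    ← card_blockSizes_eq (fun j hj => i.blocks_pos hj) i.blocks_sum, Finset.card_filter]
  congr 1
  refine Finset.sum_congr rfl fun p _ => ?_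
  simp only [Composition.ext_iff, toComposition]

end Combinatorics

/-! ### Jets of curves in a normed space and of A(u)u' -/

section Calculus

variable {E F F' : Type*} [NormedAddCommGroup E] [NormedSpace ℝ E]
  [NormedAddCommGroup F] [NormedSpace ℝ F] [NormedAddCommGroup F'] [NormedSpace ℝ F']

theorem contDiffAt_deriv {u : ℝ → E} {t : ℝ} (hu : ContDiffAt ℝ ∞ u t) :
    ContDiffAt ℝ ∞ (deriv u) t :=
  hu.derivWithin (by simp)

theorem eventually_differentiableAt {u : E → F} {x : E} (hu : ContDiffAt ℝ ∞ u x) :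
    ∀ᶠ y in nhds x, DifferentiableAt ℝ u y :=
  ((hu.of_le (m := 1) (by simp)).eventually (by simp)).mono
    fun _ h => h.differentiableAt (by simp)

theorem contDiffAt_bilinear (B : E →L[ℝ] F →L[ℝ] F') {f : ℝ → E} {w : ℝ → F} {t : ℝ}
    (hf : ContDiffAt ℝ ∞ f t) (hw : ContDiffAt ℝ ∞ w t) :
    ContDiffAt ℝ ∞ (fun s => B (f s) (w s)) t :=
  B.isBoundedBilinearMap.contDiff.contDiffAt.comp t (hf.prodMk hw)

/-- If `w` vanishes to order `n`, then the derivatives of `B f w` up to order `n` only involve the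
value of `f`. -/
theorem iteratedDeriv_bilinear_of_vanish (B : E →L[ℝ] F →L[ℝ] F') {f : ℝ → E} {w : ℝ → F} {t : ℝ}
    (hf : ContDiffAt ℝ ∞ f t) (hw : ContDiffAt ℝ ∞ w t) {n j : ℕ}
    (h : ∀ i < n, iteratedDeriv i w t = 0) (hj : j ≤ n) :
    iteratedDeriv j (fun s => B (f s) (w s)) t = B (f t) (iteratedDeriv j w t) := by
  induction j generalizing f w n with
  | zero => simp
  | succ j ih =>
    obtain ⟨n, rfl⟩ : ∃ m, n = m + 1 := ⟨n - 1, by omega⟩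
    -- In the product rule, B(f, w') falls under induction with `n` lowered by one, while B(f', w)
    -- contributes only the vanishing derivative of `w` of order `j`.
    have e : deriv (fun s => B (f s) (w s)) =ᶠ[nhds t]
        (fun s => B (f s) (deriv w s)) + fun s => B (deriv f s) (w s) := by
      filter_upwards [eventually_differentiableAt hf, eventually_differentiableAt hw] with s h1 h2
      exact B.deriv_of_bilinear (fun _ => h1) fun _ => h2
    have hle : (j : WithTop ℕ∞) ≤ ∞ := by exact_mod_cast le_top
    rw [iteratedDeriv_succ', e.iteratedDeriv_eq, iteratedDeriv_add
        ((contDiffAt_bilinear B hf (contDiffAt_deriv hw)).of_le hle)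
        ((contDiffAt_bilinear B (contDiffAt_deriv hf) hw).of_le hle),
      ih hf (contDiffAt_deriv hw) (n := n)
        (fun i hi => by rw [← iteratedDeriv_succ']; exact h _ (by omega)) (by omega),
      ih (contDiffAt_deriv hf) hw h (by omega), h j (by omega), iteratedDeriv_succ']
    simp

/-- The leading part of the derivatives at `0` of the logarithmic derivative `A(u) u'`. -/
theorem iteratedDeriv_logDeriv_sub {A : E → E →L[ℝ] E} {u v : ℝ → E}
    (hA : ContDiffAt ℝ ∞ A (u 0)) (hu : ContDiffAt ℝ ∞ u 0) (hv : ContDiffAt ℝ ∞ v 0) {n : ℕ}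
    (h : ∀ j ≤ n, iteratedDeriv j u 0 = iteratedDeriv j v 0) :
    iteratedDeriv n (fun t => A (u t) (deriv u t)) 0 -
        iteratedDeriv n (fun t => A (v t) (deriv v t)) 0 =
      A (u 0) (iteratedDeriv (n + 1) u 0 - iteratedDeriv (n + 1) v 0) := by
  have h0 : u 0 = v 0 := by simpa using h 0 (Nat.zero_le _)
  have hA' : ContDiffAt ℝ ∞ A (v 0) := h0 ▸ hA
  have hAu : ContDiffAt ℝ ∞ (A ∘ u) 0 := hA.comp 0 hu
  have hAv : ContDiffAt ℝ ∞ (A ∘ v) 0 := hA'.comp 0 hv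
  have hu' := contDiffAt_deriv hu
  have hv' := contDiffAt_deriv hv
  have le (j : ℕ) : (j : WithTop ℕ∞) ≤ ∞ := by exact_mod_cast le_top
  have hWu : ContDiffAt ℝ ∞ (fun t => A (u t) (deriv u t)) 0 := hAu.clm_apply hu'
  have hWv : ContDiffAt ℝ ∞ (fun t => A (v t) (deriv v t)) 0 := hAv.clm_apply hv'
  -- A(u)u' - A(v)v' = A(u)(u' - v') + (A(u) - A(v))v'. The second summand vanishes to order n at 0,
  -- and the first keeps only its leading part.
  have e : (fun t => A (u t) (deriv u t)) - (fun t => A (v t) (deriv v t)) =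
      (fun t => ContinuousLinearMap.id ℝ (E →L[ℝ] E) ((A ∘ u) t) ((deriv u - deriv v) t)) +
      fun t => (ContinuousLinearMap.id ℝ (E →L[ℝ] E)).flip (deriv v t) ((A ∘ u - A ∘ v) t) := by
    funext t
    simp
  have hd : ContDiffAt ℝ ∞ (deriv u - deriv v) 0 := hu'.sub hv'
  have hdA : ContDiffAt ℝ ∞ (A ∘ u - A ∘ v) 0 := hAu.sub hAv
  have d1 : ∀ i < n, iteratedDeriv i (deriv u - deriv v) 0 = 0 := by
    intro i hi
    rw [iteratedDeriv_sub (hu'.of_le (le i)) (hv'.of_le (le i)), ← iteratedDeriv_succ',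
      ← iteratedDeriv_succ', h _ (by omega), sub_self]
  have d2 : ∀ i ≤ n, iteratedDeriv i (A ∘ u - A ∘ v) 0 = 0 := by
    intro i hi
    rw [iteratedDeriv_sub (hAu.of_le (le i)) (hAv.of_le (le i)), sub_eq_zero,
      iteratedDeriv_eq_iff_iteratedFDeriv_eq]
    exact iteratedFDeriv_comp_congr hA hu hv
      (fun j hj => iteratedDeriv_eq_iff_iteratedFDeriv_eq.1 (h j hj)) i hi
  rw [← iteratedDeriv_sub (hWu.of_le (le n)) (hWv.of_le (le n)), e, iteratedDeriv_add
      ((contDiffAt_bilinear _ hAu hd).of_le (le n))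
      ((contDiffAt_bilinear _ hv' hdA).of_le (le n)),
    iteratedDeriv_bilinear_of_vanish _ hAu hd d1 le_rfl,
    iteratedDeriv_bilinear_of_vanish _ hv' hdA (fun i hi => d2 i hi.le) le_rfl,
    d2 n le_rfl, iteratedDeriv_sub (hu'.of_le (le n)) (hv'.of_le (le n)), ← iteratedDeriv_succ',
    ← iteratedDeriv_succ']
  simp

/-- The jets of two curves through the same point coincide up to order `k` if and only if the
jets of their logarithmic derivatives coincide up to order `k - 1`. -/
theorem iteratedDeriv_eq_iff_logDeriv {A : E → E →L[ℝ] E} {u v : ℝ → E}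
    (hA : ContDiffAt ℝ ∞ A (u 0)) (hA0 : A (u 0) = ContinuousLinearMap.id ℝ E)
    (hu : ContDiffAt ℝ ∞ u 0) (hv : ContDiffAt ℝ ∞ v 0) (h0 : u 0 = v 0) (k : ℕ) :
    (∀ j ≤ k, iteratedDeriv j u 0 = iteratedDeriv j v 0) ↔
      ∀ j < k, iteratedDeriv j (fun t => A (u t) (deriv u t)) 0 =
        iteratedDeriv j (fun t => A (v t) (deriv v t)) 0 := by
  constructor
  · intro h j hj
    rw [← sub_eq_zero, iteratedDeriv_logDeriv_sub hA hu hv fun i hi => h i (by omega),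
      h _ hj, sub_self, map_zero]
  · intro h j
    induction j using Nat.strong_induction_on with
    | _ j ih =>
      intro hj
      cases j with
      | zero => simpa using h0
      | succ j =>
        have := iteratedDeriv_logDeriv_sub hA hu hv fun i (hi : i ≤ j) =>
          ih i (by omega) (by omega)
        rw [h j (by omega), sub_self, hA0, ContinuousLinearMap.id_apply] at this
        exact sub_eq_zero.1 this.symm

/-- The jet of the logarithmic derivative can be prescribed. -/
theorem exists_logDeriv_eq {A : E → E →L[ℝ] E} {p : E} (hA : ContDiffAt ℝ ∞ A p)
    (hA0 : A p = ContinuousLinearMap.id ℝ E) (x : ℕ → E) (n : ℕ) :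
    ∃ u : ℝ → E, ContDiff ℝ ∞ u ∧ u 0 = p ∧
      ∀ j < n, iteratedDeriv j (fun t => A (u t) (deriv u t)) 0 = x j := by
  induction n with
  | zero => exact ⟨fun _ => p, contDiff_const, rfl, by simp⟩
  | succ n ih =>
    obtain ⟨u, hu, rfl, h⟩ := ih
    set w := x n - iteratedDeriv n (fun t => A (u t) (deriv u t)) 0 with hw
    -- The only nonzero derivative of this monomial at 0 is `w`, in order n + 1. Adding it corrects
    -- the derivative of order n of A(u)u' and keeps the lower ones.
    let q : ℝ → E := fun t => t ^ (n + 1) • (((n + 1).factorial : ℝ)⁻¹ • w)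
    have hpow : ContDiff ℝ ∞ fun t : ℝ => t ^ (n + 1) := contDiff_id.pow _
    have hq : ContDiff ℝ ∞ q := hpow.smul contDiff_const
    have le (j : ℕ) : (j : WithTop ℕ∞) ≤ ∞ := by exact_mod_cast le_top
    have dq : ∀ j, iteratedDeriv j q 0 = if j = n + 1 then w else 0 := by
      intro j
      simp only [q]
      rw [iteratedDeriv_smul_const (hpow.contDiffAt.of_le (le j)), iteratedDeriv_fun_pow_zero]
      split_ifs
      · rw [smul_smul, mul_inv_cancel₀ (by positivity), one_smul]
      · simp
    have hv : ContDiff ℝ ∞ (u + q) := hu.add hq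
    have dv : ∀ j, iteratedDeriv j (u + q) 0 =
        iteratedDeriv j u 0 + if j = n + 1 then w else 0 := fun j => by
      rw [iteratedDeriv_add (hu.contDiffAt.of_le (le j)) (hq.contDiffAt.of_le (le j)), dq]
    have hv0 : (u + q) 0 = u 0 := by simp [q]
    have hagree : ∀ j ≤ n, iteratedDeriv j (u + q) 0 = iteratedDeriv j u 0 := fun j hj => by
      rw [dv, if_neg (by omega), add_zero]
    rw [← hv0] at hA hA0
    refine ⟨u + q, hv, hv0, fun j hj => ?_⟩
    have key := iteratedDeriv_logDeriv_sub hA hv.contDiffAt hu.contDiffAt (n := j)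
      fun i hi => hagree i (by omega)
    rw [hA0, ContinuousLinearMap.id_apply, dv, add_sub_cancel_left, sub_eq_iff_eq_add] at key
    rw [key]
    split_ifs with hjn
    · obtain rfl : j = n := by omega
      rw [hw, sub_add_cancel]
    · rw [zero_add, h j (by omega)]

end Calculus

set_option linter.unusedSectionVars false

/-! ### The group operations in the chart around the neutral element -/

noncomputable section

variable {E : Type*} [NormedAddCommGroup E] [NormedSpace ℝ E]
  {H : Type*} [TopologicalSpace H] (I : ModelWithCorners ℝ E H)
  (G : Type*) [TopologicalSpace G] [ChartedSpace H G] [Group G]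

/-- The coordinates of the neutral element in the chart around it. -/
def chartOne : E := extChartAt I (1 : G) 1

variable {G} in
/-- A map `G × G → G` read in the chart around the neutral element. -/
def chartLift (f : G × G → G) (p : E × E) : E :=
  extChartAt I (1 : G) (f ((extChartAt I (1 : G)).symm p.1, (extChartAt I (1 : G)).symm p.2))

/-- Multiplication in the chart. -/
def chartMul : E × E → E := chartLift I fun x : G × G => x.1 * x.2

/-- Division in the chart. -/
def chartDiv : E × E → E := chartLift I fun x : G × G => x.1 * x.2⁻¹

/-- Conjugation in the chart. -/
def chartConj : E × E → E := chartLift I fun x : G × G => x.1 * x.2 * x.1⁻¹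

theorem symm_chartOne : (extChartAt I (1 : G)).symm (chartOne I G) = 1 :=
  extChartAt_to_inv 1

variable {G} in
theorem chartLift_apply (f : G × G → G) {a b : G} (ha : a ∈ (extChartAt I (1 : G)).source)
    (hb : b ∈ (extChartAt I (1 : G)).source) :
    chartLift I f (extChartAt I (1 : G) a, extChartAt I (1 : G) b) =
      extChartAt I (1 : G) (f (a, b)) := by
  rw [chartLift, (extChartAt I (1 : G)).left_inv ha, (extChartAt I (1 : G)).left_inv hb]

section LieGroup

variable [I.Boundaryless] [LieGroup I ∞ G]

theorem eventually_mem_target :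
    ∀ᶠ p in nhds (chartOne I G), p ∈ (extChartAt I (1 : G)).target :=
  extChartAt_target_mem_nhds 1

theorem eventually_mem_source {X : Type*} [TopologicalSpace X] {a : X → G} {x : X}
    (ha : ContinuousAt a x) (h1 : a x = 1) :
    ∀ᶠ y in nhds x, a y ∈ (extChartAt I (1 : G)).source :=
  ha.eventually (by rw [h1]; exact extChartAt_source_mem_nhds 1)

theorem contMDiffAt_symm_chartOne :
    ContMDiffAt 𝓘(ℝ, E) I ∞ (extChartAt I (1 : G)).symm (chartOne I G) :=
  (contMDiffOn_extChartAt_symm (1 : G)).contMDiffAt (extChartAt_target_mem_nhds 1)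

variable {G} in
theorem contMDiffAt_lift {f : G × G → G} (hf : ContMDiff (I.prod I) I ∞ f) :
    ContMDiffAt 𝓘(ℝ, E × E) I ∞ (fun p : E × E => f ((extChartAt I (1 : G)).symm p.1,
      (extChartAt I (1 : G)).symm p.2)) (chartOne I G, chartOne I G) := by
  have h1 : ContMDiffAt 𝓘(ℝ, E × E) I ∞ (fun p : E × E => (extChartAt I (1 : G)).symm p.1)
      (chartOne I G, chartOne I G) :=
    (contMDiffAt_symm_chartOne I G).comp (chartOne I G, chartOne I G)
      contDiff_fst.contMDiff.contMDiffAt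
  have h2 : ContMDiffAt 𝓘(ℝ, E × E) I ∞ (fun p : E × E => (extChartAt I (1 : G)).symm p.2)
      (chartOne I G, chartOne I G) :=
    (contMDiffAt_symm_chartOne I G).comp (chartOne I G, chartOne I G)
      contDiff_snd.contMDiff.contMDiffAt
  exact hf.contMDiffAt.comp (chartOne I G, chartOne I G) (h1.prodMk h2)

variable {G} in
theorem contDiffAt_extChartAt_comp {F : Type*} [NormedAddCommGroup F] [NormedSpace ℝ F]
    {f : F → G} {x : F} (hf : ContMDiffAt 𝓘(ℝ, F) I ∞ f x) (h1 : f x = 1) :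
    ContDiffAt ℝ ∞ (fun y => extChartAt I (1 : G) (f y)) x := by
  rw [← contMDiffAt_iff_contDiffAt]
  have : ContMDiffAt I 𝓘(ℝ, E) ∞ (extChartAt I (1 : G)) (f x) := by
    rw [h1]
    exact contMDiffAt_extChartAt
  exact this.comp x hf

variable {G} in
theorem contDiffAt_chartLift {f : G × G → G} (hf : ContMDiff (I.prod I) I ∞ f)
    (h1 : f (1, 1) = 1) :
    ContDiffAt ℝ ∞ (chartLift I f) (chartOne I G, chartOne I G) :=
  contDiffAt_extChartAt_comp I (contMDiffAt_lift I hf) (by simpa only [symm_chartOne] using h1)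

variable {G} in
theorem eventually_symm_chartLift {f : G × G → G} (hf : ContMDiff (I.prod I) I ∞ f)
    (h1 : f (1, 1) = 1) :
    ∀ᶠ p in nhds (chartOne I G, chartOne I G), (extChartAt I (1 : G)).symm (chartLift I f p) =
      f ((extChartAt I (1 : G)).symm p.1, (extChartAt I (1 : G)).symm p.2) := by
  filter_upwards [eventually_mem_source I G (contMDiffAt_lift I hf).continuousAt
    (by simpa only [symm_chartOne] using h1)] with p hp
  exact (extChartAt I (1 : G)).left_inv hp

theorem contMDiff_mul' : ContMDiff (I.prod I) I ∞ fun x : G × G => x.1 * x.2 := contMDiff_mul I ∞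

theorem contMDiff_div' : ContMDiff (I.prod I) I ∞ fun x : G × G => x.1 * x.2⁻¹ :=
  contMDiff_fst.mul contMDiff_snd.inv

theorem contMDiff_conj : ContMDiff (I.prod I) I ∞ fun x : G × G => x.1 * x.2 * x.1⁻¹ :=
  (contMDiff_fst.mul contMDiff_snd).mul contMDiff_fst.inv

theorem contDiffAt_chartMul : ContDiffAt ℝ ∞ (chartMul I G) (chartOne I G, chartOne I G) :=
  contDiffAt_chartLift I (contMDiff_mul' I G) (by simp)

theorem contDiffAt_chartDiv : ContDiffAt ℝ ∞ (chartDiv I G) (chartOne I G, chartOne I G) :=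
  contDiffAt_chartLift I (contMDiff_div' I G) (by simp)

theorem contDiffAt_chartConj : ContDiffAt ℝ ∞ (chartConj I G) (chartOne I G, chartOne I G) :=
  contDiffAt_chartLift I (contMDiff_conj I G) (by simp)

/-! ### Partial derivatives -/

/-- The derivative in the second variable, at the neutral element. -/
def partialSnd (F : E × E → E) (p : E) : E →L[ℝ] E :=
  fderiv ℝ (fun q => F (p, q)) (chartOne I G)

/-- The derivative in the first variable, at the neutral element. -/
def partialFst (F : E × E → E) (p : E) : E →L[ℝ] E :=
  fderiv ℝ (fun q => F (q, p)) (chartOne I G)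

variable {F : E × E → E}

theorem eventually_differentiableAt_snd
    (hF : ContDiffAt ℝ ∞ F (chartOne I G, chartOne I G)) :
    ∀ᶠ p in nhds (chartOne I G), DifferentiableAt ℝ F (p, chartOne I G) :=
  (Continuous.prodMk_left (chartOne I G)).continuousAt.eventually (eventually_differentiableAt hF)

theorem eventually_differentiableAt_fst
    (hF : ContDiffAt ℝ ∞ F (chartOne I G, chartOne I G)) :
    ∀ᶠ p in nhds (chartOne I G), DifferentiableAt ℝ F (chartOne I G, p) :=
  (Continuous.prodMk_right (chartOne I G)).continuousAt.eventually (eventually_differentiableAt hF)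

theorem partialSnd_eq (hF : ContDiffAt ℝ ∞ F (chartOne I G, chartOne I G)) :
    partialSnd I G F =ᶠ[nhds (chartOne I G)] fun p =>
      (fderiv ℝ F (p, chartOne I G)).comp (ContinuousLinearMap.inr ℝ E E) := by
  filter_upwards [eventually_differentiableAt_snd I G hF] with p hp
  exact (hp.hasFDerivAt.comp (chartOne I G) (hasFDerivAt_prodMk_right p (chartOne I G))).fderiv

theorem partialFst_eq (hF : ContDiffAt ℝ ∞ F (chartOne I G, chartOne I G)) :
    partialFst I G F =ᶠ[nhds (chartOne I G)] fun p =>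
      (fderiv ℝ F (chartOne I G, p)).comp (ContinuousLinearMap.inl ℝ E E) := by
  filter_upwards [eventually_differentiableAt_fst I G hF] with p hp
  exact (hp.hasFDerivAt.comp (chartOne I G) (hasFDerivAt_prodMk_left (chartOne I G) p)).fderiv

theorem contDiffAt_partialSnd (hF : ContDiffAt ℝ ∞ F (chartOne I G, chartOne I G)) :
    ContDiffAt ℝ ∞ (partialSnd I G F) (chartOne I G) :=
  ContDiffAt.fderiv (f := fun p q => F (p, q)) (n := ∞) hF contDiffAt_const (by simp)

theorem contDiffAt_partialFst (hF : ContDiffAt ℝ ∞ F (chartOne I G, chartOne I G)) :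
    ContDiffAt ℝ ∞ (partialFst I G F) (chartOne I G) :=
  ContDiffAt.fderiv (f := fun p q => F (q, p)) (n := ∞)
    (hF.comp (chartOne I G, chartOne I G) (contDiff_snd.prodMk contDiff_fst).contDiffAt)
    contDiffAt_const (by simp)

theorem fderiv_partialSnd (hF : ContDiffAt ℝ ∞ F (chartOne I G, chartOne I G)) (v w : E) :
    fderiv ℝ (partialSnd I G F) (chartOne I G) v w =
      fderiv ℝ (fderiv ℝ F) (chartOne I G, chartOne I G) (v, 0) (0, w) := by
  have hd : DifferentiableAt ℝ (fderiv ℝ F) (chartOne I G, chartOne I G) :=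
    (hF.fderiv_right (m := ∞) (by simp)).differentiableAt (by simp)
  have h1 := HasFDerivAt.comp (f := fun p => (p, chartOne I G)) (chartOne I G) hd.hasFDerivAt
    (hasFDerivAt_prodMk_left (chartOne I G) (chartOne I G))
  have h2 := h1.clm_comp (hasFDerivAt_const (ContinuousLinearMap.inr ℝ E E) (chartOne I G))
  rw [(partialSnd_eq I G hF).fderiv_eq]
  have h3 := h2.fderiv
  simp only [Function.comp_def] at h3
  rw [h3]
  simp

theorem fderiv_partialFst (hF : ContDiffAt ℝ ∞ F (chartOne I G, chartOne I G)) (v w : E) :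
    fderiv ℝ (partialFst I G F) (chartOne I G) v w =
      fderiv ℝ (fderiv ℝ F) (chartOne I G, chartOne I G) (0, v) (w, 0) := by
  have hd : DifferentiableAt ℝ (fderiv ℝ F) (chartOne I G, chartOne I G) :=
    (hF.fderiv_right (m := ∞) (by simp)).differentiableAt (by simp)
  have h1 := HasFDerivAt.comp (f := fun p => (chartOne I G, p)) (chartOne I G) hd.hasFDerivAt
    (hasFDerivAt_prodMk_right (chartOne I G) (chartOne I G))
  have h2 := h1.clm_comp (hasFDerivAt_const (ContinuousLinearMap.inl ℝ E E) (chartOne I G))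
  rw [(partialFst_eq I G hF).fderiv_eq]
  have h3 := h2.fderiv
  simp only [Function.comp_def] at h3
  rw [h3]
  simp

/-- Both sides are mixed second derivatives of F at the same point, with the order of
differentiation exchanged. -/
theorem fderiv_partialFst_eq_partialSnd (hF : ContDiffAt ℝ ∞ F (chartOne I G, chartOne I G))
    (v w : E) :
    fderiv ℝ (partialFst I G F) (chartOne I G) v w =
      fderiv ℝ (partialSnd I G F) (chartOne I G) w v := by
  rw [fderiv_partialFst I G hF, fderiv_partialSnd I G hF]
  have h2 (n : ℕ) : (n : WithTop ℕ∞) ≤ ∞ := by exact_mod_cast le_top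
  exact (hF.isSymmSndFDerivAt (by simpa using h2 2)).eq _ _

theorem fderiv_eq_id {f : E → E} (hf : ∀ p ∈ (extChartAt I (1 : G)).target, f p = p) :
    fderiv ℝ f (chartOne I G) = ContinuousLinearMap.id ℝ E := by
  have : f =ᶠ[nhds (chartOne I G)] id := (eventually_mem_target I G).mono hf
  rw [this.fderiv_eq, fderiv_id]

theorem partialSnd_chartMul : partialSnd I G (chartMul I G) (chartOne I G) =
    ContinuousLinearMap.id ℝ E :=
  fderiv_eq_id I G fun p hp => by
    simp only [chartMul, chartLift, symm_chartOne, one_mul,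
      (extChartAt I (1 : G)).right_inv hp]

theorem partialFst_chartMul : partialFst I G (chartMul I G) (chartOne I G) =
    ContinuousLinearMap.id ℝ E :=
  fderiv_eq_id I G fun p hp => by
    simp only [chartMul, chartLift, symm_chartOne, mul_one,
      (extChartAt I (1 : G)).right_inv hp]

theorem partialSnd_chartConj : partialSnd I G (chartConj I G) (chartOne I G) =
    ContinuousLinearMap.id ℝ E :=
  fderiv_eq_id I G fun p hp => by
    simp only [chartConj, chartLift, symm_chartOne, one_mul, mul_one, inv_one,
      (extChartAt I (1 : G)).right_inv hp]

theorem chartConj_chartOne (p : E) : chartConj I G (p, chartOne I G) = chartOne I G := by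
  simp only [chartConj, chartLift, symm_chartOne, mul_one, mul_inv_cancel]
  rfl

/-- The derivative in the chart of `a x = (a x a⁻¹) a` with respect to `x`. -/
theorem partialFst_comp_partialSnd_chartConj :
    ∀ᶠ p in nhds (chartOne I G), (partialFst I G (chartMul I G) p).comp
      (partialSnd I G (chartConj I G) p) = partialSnd I G (chartMul I G) p := by
  have h := (eventually_symm_chartLift I (contMDiff_conj I G) (by simp : (1 : G) * 1 * 1⁻¹ = 1)).curry_nhds
  filter_upwards [h, eventually_differentiableAt_fst I G (contDiffAt_chartMul I G),
    eventually_differentiableAt_snd I G (contDiffAt_chartConj I G)] with p hp h1 h2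
  have d1 : HasFDerivAt (fun q => chartMul I G (q, p)) (partialFst I G (chartMul I G) p)
      (chartConj I G (p, chartOne I G)) := by
    rw [chartConj_chartOne]
    exact (h1.comp (chartOne I G)
      (hasFDerivAt_prodMk_left (chartOne I G) p).differentiableAt).hasFDerivAt
  have d2 : HasFDerivAt (fun q => chartConj I G (p, q)) (partialSnd I G (chartConj I G) p)
      (chartOne I G) :=
    (h2.comp (chartOne I G)
      (hasFDerivAt_prodMk_right p (chartOne I G)).differentiableAt).hasFDerivAt
  have d3 := d1.comp (chartOne I G) d2
  rw [← d3.fderiv, partialSnd]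
  refine Filter.EventuallyEq.fderiv_eq ?_
  filter_upwards [hp] with q hq
  change extChartAt I (1 : G) ((extChartAt I (1 : G)).symm (chartLift I
    (fun x : G × G => x.1 * x.2 * x.1⁻¹) (p, q)) * _) = extChartAt I (1 : G) _
  rw [hq]
  simp

/-- Differentiating (∂₁m)(p) ∘ Ad_p = (∂₂m)(p) at the neutral element, where ∂₁m and Ad are the
identity, gives D(Ad) = D(∂₂m) - D(∂₁m). Symmetry of second derivatives turns D(∂₁m) into D(∂₂m)
with arguments exchanged. -/
theorem fderiv_partialSnd_chartConj (v w : E) :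
    fderiv ℝ (partialSnd I G (chartConj I G)) (chartOne I G) v w =
      fderiv ℝ (partialSnd I G (chartMul I G)) (chartOne I G) v w -
        fderiv ℝ (partialSnd I G (chartMul I G)) (chartOne I G) w v := by
  have hm := contDiffAt_chartMul I G
  have d1 := ((contDiffAt_partialFst I G hm).differentiableAt (by simp)).hasFDerivAt
  have d2 := ((contDiffAt_partialSnd I G (contDiffAt_chartConj I G)).differentiableAt
    (by simp)).hasFDerivAt
  have d3 := (d1.clm_comp d2).fderiv
  rw [Filter.EventuallyEq.fderiv_eq (partialFst_comp_partialSnd_chartConj I G)] at d3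
  have d4 := congrArg (fun L => L v w) d3
  simp only [add_apply, ContinuousLinearMap.comp_apply,
    ContinuousLinearMap.compL_apply, ContinuousLinearMap.flip_apply, partialFst_chartMul,
    partialSnd_chartConj, ContinuousLinearMap.id_apply, fderiv_partialFst_eq_partialSnd I G hm]
    at d4
  rw [d4, add_sub_cancel_right]

end LieGroup

end

/-! ### The adjoint action and the Lie bracket in the chart -/

noncomputable section

variable {E : Type*} [NormedAddCommGroup E] [NormedSpace ℝ E]
  {H : Type*} [TopologicalSpace H] (I : ModelWithCorners ℝ E H)
  {G : Type*} [TopologicalSpace G] [ChartedSpace H G] [Group G]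
  [I.Boundaryless] [LieGroup I ∞ G]

/-- The tangent map of a map into `G` at a point mapped to `1`, in the chart around `1`. -/
theorem mfderiv_apply_of_eq_one {E' : Type*} [NormedAddCommGroup E'] [NormedSpace ℝ E']
    {H' : Type*} [TopologicalSpace H'] {I' : ModelWithCorners ℝ E' H'} [I'.Boundaryless]
    {M : Type*} [TopologicalSpace M] [ChartedSpace H' M] {f : M → G} {x : M}
    (hf : MDifferentiableAt I' I f x) (h1 : f x = 1) (v : E') :
    (mfderiv I' I f x v : E) =
      fderiv ℝ (fun y => extChartAt I (1 : G) (f ((extChartAt I' x).symm y))) (extChartAt I' x x)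
        v := by
  rw [hf.mfderiv, I'.range_eq_univ, fderivWithin_univ]
  unfold writtenInExtChartAt
  rw [h1]
  rfl

/-- The adjoint action as a continuous linear map. -/
def adL (g : G) : E →L[ℝ] E :=
  fderiv ℝ (fun p => extChartAt I (1 : G) (g * (extChartAt I (1 : G)).symm p * g⁻¹)) (chartOne I G)

theorem contMDiff_conj_left (g : G) : ContMDiff I I ∞ fun h : G => g * h * g⁻¹ :=
  (contMDiff_const.mul contMDiff_id).mul contMDiff_const

theorem Ad_eq_adL (g : G) (v : GroupLieAlgebra I G) : Ad g v = adL I g v :=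
  mfderiv_apply_of_eq_one (I' := I) I
    ((contMDiff_conj_left I g).contMDiffAt.mdifferentiableAt (by simp)) (by simp) v

/-- Conjugation by `g` in the chart. -/
def chartConjBy (g : G) (p : E) : E :=
  extChartAt I (1 : G) (g * (extChartAt I (1 : G)).symm p * g⁻¹)

theorem chartConjBy_chartOne (g : G) : chartConjBy I g (chartOne I G) = chartOne I G := by
  simp only [chartConjBy, symm_chartOne, mul_one, mul_inv_cancel]
  rfl

theorem contMDiffAt_conj_symm (g : G) : ContMDiffAt 𝓘(ℝ, E) I ∞
    (fun p => g * (extChartAt I (1 : G)).symm p * g⁻¹) (chartOne I G) :=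
  (contMDiff_conj_left I g).contMDiffAt.comp (chartOne I G) (contMDiffAt_symm_chartOne I G)

theorem hasFDerivAt_chartConjBy (g : G) :
    HasFDerivAt (chartConjBy I g) (adL I g) (chartOne I G) :=
  ((contDiffAt_extChartAt_comp I (contMDiffAt_conj_symm I g)
    (by simp only [symm_chartOne, mul_one, mul_inv_cancel])).differentiableAt
      (by simp)).hasFDerivAt

theorem adL_mul (g h : G) : adL I (g * h) = (adL I g).comp (adL I h) := by
  have d1 := hasFDerivAt_chartConjBy I g
  rw [← chartConjBy_chartOne I h] at d1
  rw [← (d1.comp (chartOne I G) (hasFDerivAt_chartConjBy I h)).fderiv]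
  refine Filter.EventuallyEq.fderiv_eq ?_
  filter_upwards [eventually_mem_source I G (contMDiffAt_conj_symm I h).continuousAt
    (by simp only [symm_chartOne, mul_one, mul_inv_cancel])] with p hp
  simp only [Function.comp_apply, chartConjBy]
  rw [(extChartAt I (1 : G)).left_inv hp]
  congr 1
  group

theorem adL_one : adL I (1 : G) = ContinuousLinearMap.id ℝ E :=
  fderiv_eq_id I G fun p hp => by
    simp only [one_mul, inv_one, mul_one, (extChartAt I (1 : G)).right_inv hp]

theorem adL_inv_apply (g : G) (v : E) : adL I g⁻¹ (adL I g v) = v := by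
  have h := adL_mul I g⁻¹ g
  rw [inv_mul_cancel, adL_one] at h
  exact (congrArg (fun L => L v) h).symm

theorem adL_apply_inv (g : G) (v : E) : adL I g (adL I g⁻¹ v) = v := by
  simpa using adL_inv_apply I g⁻¹ v

/-- This exhibits Ad near 1 as a smooth operator-valued map in the chart, whose derivative at the
base point is `bracketL`. -/
theorem adL_eq_partialSnd {a : G} (ha : a ∈ (extChartAt I (1 : G)).source) :
    adL I a = partialSnd I G (chartConj I G) (extChartAt I (1 : G) a) := by
  simp only [adL, partialSnd, chartConj, chartLift, (extChartAt I (1 : G)).left_inv ha]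

/-! ### The Lie bracket -/

variable (G) in
/-- The Lie bracket as a continuous bilinear map. -/
def bracketL : E →L[ℝ] E →L[ℝ] E := fderiv ℝ (partialSnd I G (chartConj I G)) (chartOne I G)

/-- The left-invariant field at g is the derivative of x ↦ g x at 1 applied to v, which in the chart
is the second partial derivative of multiplication. -/
theorem mpullbackWithin_mulInvariantVectorField (v : GroupLieAlgebra I G) {p : E}
    (hp : p ∈ (extChartAt I (1 : G)).target) :
    VectorField.mpullbackWithin 𝓘(ℝ, E) I (extChartAt I (1 : G)).symm (mulInvariantVectorField v)
      (Set.range I) p = partialSnd I G (chartMul I G) p v := by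
  have : IsManifold I 1 G := IsManifold.of_le (n := ∞) (by simp)
  have hinv : (mfderivWithin 𝓘(ℝ, E) I (extChartAt I (1 : G)).symm (Set.range I) p).inverse =
      mfderiv I 𝓘(ℝ, E) (extChartAt I (1 : G)) ((extChartAt I (1 : G)).symm p) :=
    ContinuousLinearMap.inverse_eq (mfderivWithin_extChartAt_symm_comp_mfderiv_extChartAt hp)
      (mfderiv_extChartAt_comp_mfderivWithin_extChartAt_symm hp)
  rw [VectorField.mpullbackWithin_apply, hinv, mulInvariantVectorField]
  set g := (extChartAt I (1 : G)).symm p with hg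
  have hgs : g ∈ (chartAt H (1 : G)).source := by
    rw [← extChartAt_source I]
    exact (extChartAt I (1 : G)).map_target hp
  have d1 : MDifferentiableAt I 𝓘(ℝ, E) (extChartAt I (1 : G)) g :=
    mdifferentiableAt_extChartAt hgs
  have d2 : MDifferentiableAt I I (fun x : G => g * x) 1 :=
    (contMDiff_mul_left (n := ∞)).contMDiffAt.mdifferentiableAt (by simp)
  have d3 := mfderiv_comp_apply_of_eq (1 : G) d1 d2 (mul_one g) v
  have d4 : MDifferentiableAt I 𝓘(ℝ, E) (extChartAt I (1 : G) ∘ fun x : G => g * x) 1 :=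
    MDifferentiableAt.comp_of_eq (1 : G) d1 d2 (mul_one g)
  refine d3.symm.trans ?_
  rw [d4.mfderiv, I.range_eq_univ, fderivWithin_univ]
  rfl

/-- In the chart the left-invariant fields are p ↦ (∂₂m)(p) v, and their bracket at the base point
is the antisymmetrized derivative of ∂₂m. By `fderiv_partialSnd_chartConj` this is the derivative of
Ad. -/
theorem bracket_eq [CompleteSpace E] (v w : GroupLieAlgebra I G) : ⁅v, w⁆ = bracketL I G v w := by
  have : IsManifold I 1 G := IsManifold.of_le (n := ∞) (by simp)
  have hmul := contDiffAt_partialSnd I G (contDiffAt_chartMul I G)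
  have hV : ∀ v : GroupLieAlgebra I G, VectorField.mpullbackWithin 𝓘(ℝ, E) I
      (extChartAt I (1 : G)).symm (mulInvariantVectorField v) (Set.range I) =ᶠ[nhds (chartOne I G)]
        fun p => partialSnd I G (chartMul I G) p v := by
    intro v
    filter_upwards [eventually_mem_target I G] with p hp
    exact mpullbackWithin_mulInvariantVectorField I v hp
  have hd : ∀ v u : E, fderiv ℝ (fun p => partialSnd I G (chartMul I G) p v) (chartOne I G) u =
      fderiv ℝ (partialSnd I G (chartMul I G)) (chartOne I G) u v := by
    intro v u
    have := ((hmul.differentiableAt (by simp)).hasFDerivAt.clm_apply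
      (hasFDerivAt_const v (chartOne I G))).fderiv
    rw [this]
    simp
  have hfinal : ∀ v w : E, VectorField.lieBracket ℝ (fun p => partialSnd I G (chartMul I G) p v)
      (fun p => partialSnd I G (chartMul I G) p w) (chartOne I G) = bracketL I G v w := by
    intro v w
    rw [VectorField.lieBracket, hd, hd, partialSnd_chartMul, bracketL,
      fderiv_partialSnd_chartConj]
    rfl
  -- The derivative of the chart at its own base point is the identity, so the final pullback in
  -- `mlieBracketWithin` changes nothing.
  have hid : ∀ u : E,
      ((mfderiv I 𝓘(ℝ, E) (extChartAt I (1 : G)) 1).inverse u : E) = u := by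
    intro u
    rw [mfderiv_extChartAt_self]
    exact congrArg (fun L : E →L[ℝ] E => L u) ContinuousLinearMap.inverse_id
  rw [GroupLieAlgebra.bracket_def, VectorField.mlieBracket, VectorField.mlieBracketWithin_apply]
  refine (hid _).trans ?_
  have hr : (extChartAt I (1 : G)).symm ⁻¹' Set.univ ∩ Set.range I = Set.univ := by
    rw [Set.preimage_univ, Set.univ_inter, I.range_eq_univ]
  rw [hr]
  refine (congrFun (VectorField.lieBracketWithin_univ (𝕜 := ℝ) (E := E)) _).trans ?_
  exact (Filter.EventuallyEq.lieBracket_vectorField_eq (𝕜 := ℝ) (E := E) (hV v) (hV w)).trans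
    (hfinal v w)

end

/-! ### The right logarithmic derivative of curves -/

noncomputable section

variable {E : Type*} [NormedAddCommGroup E] [NormedSpace ℝ E]
  {H : Type*} [TopologicalSpace H] {I : ModelWithCorners ℝ E H}
  {G : Type*} [TopologicalSpace G] [ChartedSpace H G] [Group G]
  [I.Boundaryless] [LieGroup I ∞ G]

/-- The curve `c` translated to the neutral element at time `t₀`, in the chart. -/
def localCurve (c : Curve I G) (t₀ t : ℝ) : E := extChartAt I (1 : G) (c t * (c t₀)⁻¹)

theorem contMDiff_translate (c : Curve I G) (t₀ : ℝ) :
    ContMDiff 𝓘(ℝ, ℝ) I ∞ fun t => c t * (c t₀)⁻¹ :=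
  c.contMDiff.mul contMDiff_const

theorem localCurve_self (c : Curve I G) (t₀ : ℝ) : localCurve c t₀ t₀ = chartOne I G := by
  simp only [localCurve, mul_inv_cancel]
  rfl

theorem contDiffAt_localCurve (c : Curve I G) (t₀ : ℝ) : ContDiffAt ℝ ∞ (localCurve c t₀) t₀ :=
  contDiffAt_extChartAt_comp I (contMDiff_translate c t₀).contMDiffAt (mul_inv_cancel _)

theorem eventually_translate_mem_source (c : Curve I G) (t₀ : ℝ) :
    ∀ᶠ t in nhds t₀, c t * (c t₀)⁻¹ ∈ (extChartAt I (1 : G)).source :=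
  eventually_mem_source I G (contMDiff_translate c t₀).continuous.continuousAt (mul_inv_cancel _)

/-- The right logarithmic derivative, as a curve in the model space. -/
def logDeriv (c : Curve I G) (t : ℝ) : E := rightLogDeriv c t

theorem logDeriv_eq_deriv (c : Curve I G) (t : ℝ) : logDeriv c t = deriv (localCurve c t) t := by
  have d1 : MDifferentiableAt I I (fun h : G => h * (c t)⁻¹) (c t) :=
    (contMDiff_mul_right (n := ∞)).contMDiffAt.mdifferentiableAt (by simp)
  have d2 : MDifferentiableAt 𝓘(ℝ, ℝ) I c t := c.contMDiff.contMDiffAt.mdifferentiableAt (by simp)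
  have d3 := mfderiv_comp_apply t d1 d2 (1 : ℝ)
  exact d3.symm.trans (mfderiv_apply_of_eq_one (I' := 𝓘(ℝ, ℝ)) I
    ((contMDiff_translate c t).contMDiffAt.mdifferentiableAt (by simp)) (mul_inv_cancel _) (1 : ℝ))

theorem hasDerivAt_localCurve (c : Curve I G) (t : ℝ) :
    HasDerivAt (localCurve c t) (logDeriv c t) t := by
  rw [logDeriv_eq_deriv]
  exact ((contDiffAt_localCurve c t).differentiableAt (by simp)).hasDerivAt

variable (I G) in
/-- The right trivialization of the tangent bundle, in the chart. -/
def chartTriv (p : E) : E →L[ℝ] E := fderiv ℝ (fun q => chartDiv I G (q, p)) p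

theorem contDiffAt_chartTriv : ContDiffAt ℝ ∞ (chartTriv I G) (chartOne I G) :=
  ContDiffAt.fderiv (f := fun p q => chartDiv I G (q, p)) (n := ∞)
    ((contDiffAt_chartDiv I G).comp (chartOne I G, chartOne I G)
      (contDiff_snd.prodMk contDiff_fst).contDiffAt)
    contDiffAt_id (by simp)

theorem chartTriv_chartOne : chartTriv I G (chartOne I G) = ContinuousLinearMap.id ℝ E :=
  fderiv_eq_id I G fun p hp => by
    simp only [chartDiv, chartLift, symm_chartOne, inv_one, mul_one,
      (extChartAt I (1 : G)).right_inv hp]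

/-- The curve translated by c(t)⁻¹ is a quotient of values of the one translated by c(t₀)⁻¹, because
c(s)c(t)⁻¹ = (c(s)c(t₀)⁻¹)(c(t)c(t₀)⁻¹)⁻¹. Thus a single local curve describes δʳc for all t near
t₀. -/
theorem eventually_logDeriv_eq (c : Curve I G) (t₀ : ℝ) :
    ∀ᶠ t in nhds t₀, logDeriv c t =
      chartTriv I G (localCurve c t₀ t) (deriv (localCurve c t₀) t) := by
  have hu := contDiffAt_localCurve c t₀
  have hd : ∀ᶠ p in nhds (chartOne I G), DifferentiableAt ℝ (chartDiv I G) (p, p) :=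
    (continuous_id.prodMk continuous_id).continuousAt.eventually
      (eventually_differentiableAt (contDiffAt_chartDiv I G))
  have hd' : ∀ᶠ t in nhds t₀, DifferentiableAt ℝ (chartDiv I G)
      (localCurve c t₀ t, localCurve c t₀ t) :=
    hu.continuousAt.eventually (by rwa [localCurve_self])
  filter_upwards [(eventually_translate_mem_source c t₀).eventually_nhds, hd',
    eventually_differentiableAt hu] with t h1 h2 h3
  have e : localCurve c t =ᶠ[nhds t]
      fun s => chartDiv I G (localCurve c t₀ s, localCurve c t₀ t) := by
    filter_upwards [h1] with s hs
    rw [chartDiv, localCurve, localCurve, localCurve, chartLift_apply I _ hs h1.self_of_nhds]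
    congr 1
    group
  rw [logDeriv_eq_deriv, e.deriv_eq]
  have h4 : DifferentiableAt ℝ (fun q => chartDiv I G (q, localCurve c t₀ t))
      (localCurve c t₀ t) :=
    DifferentiableAt.comp (f := fun q => (q, localCurve c t₀ t)) (localCurve c t₀ t) h2
      (hasFDerivAt_prodMk_left _ _).differentiableAt
  exact (h4.hasFDerivAt.comp_hasDerivAt t h3.hasDerivAt).deriv

theorem contDiff_logDeriv (c : Curve I G) : ContDiff ℝ ∞ (logDeriv c) := by
  refine contDiff_iff_contDiffAt.2 fun t₀ => ?_
  have hu := contDiffAt_localCurve c t₀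
  have hA : ContDiffAt ℝ ∞ (chartTriv I G) (localCurve c t₀ t₀) := by
    rw [localCurve_self]
    exact contDiffAt_chartTriv
  exact ((hA.comp t₀ hu).clm_apply (contDiffAt_deriv hu)).congr_of_eventuallyEq
    (eventually_logDeriv_eq c t₀)

/-- The derivative of `Ad_c v` along a curve `c`. -/
theorem hasDerivAt_adL (c : Curve I G) {v : ℝ → E} {v' : E} {t₀ : ℝ} (hv : HasDerivAt v v' t₀) :
    HasDerivAt (fun t => adL I (c t) (v t))
      (bracketL I G (logDeriv c t₀) (adL I (c t₀) (v t₀)) + adL I (c t₀) v') t₀ := by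
  -- Write Ad_{c(t)} as Ad_{c(t)c(t₀)⁻¹} Ad_{c(t₀)}; the first factor stays near 1, where the chart
  -- applies.
  have d1 : HasFDerivAt (partialSnd I G (chartConj I G)) (bracketL I G) (localCurve c t₀ t₀) := by
    rw [localCurve_self]
    exact ((contDiffAt_partialSnd I G (contDiffAt_chartConj I G)).differentiableAt
      (by simp)).hasFDerivAt
  have d2 := d1.comp_hasDerivAt t₀ (hasDerivAt_localCurve c t₀)
  have d3 : HasDerivAt (fun t => adL I (c t₀) (v t)) (adL I (c t₀) v') t₀ :=
    (adL I (c t₀)).hasFDerivAt.comp_hasDerivAt t₀ hv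
  have d4 := d2.clm_apply d3
  simp only [Function.comp_apply, localCurve_self, partialSnd_chartConj,
    ContinuousLinearMap.id_apply] at d4
  refine d4.congr_of_eventuallyEq ?_
  filter_upwards [eventually_translate_mem_source c t₀] with t ht
  rw [localCurve, ← adL_eq_partialSnd I ht, ← ContinuousLinearMap.comp_apply, ← adL_mul,
    inv_mul_cancel_right]

theorem fderiv_chartMul_apply (v w : E) :
    fderiv ℝ (chartMul I G) (chartOne I G, chartOne I G) (v, w) = v + w := by
  have h1 := (partialFst_eq I G (contDiffAt_chartMul I G)).self_of_nhds
  have h2 := (partialSnd_eq I G (contDiffAt_chartMul I G)).self_of_nhds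
  rw [partialFst_chartMul] at h1
  rw [partialSnd_chartMul] at h2
  have h3 := congrArg (fun L => L v) h1
  have h4 := congrArg (fun L => L w) h2
  simp only [ContinuousLinearMap.id_apply, ContinuousLinearMap.comp_apply,
    ContinuousLinearMap.inl_apply, ContinuousLinearMap.inr_apply] at h3 h4
  rw [h3, h4, ← map_add]
  simp [← h3, ← h4]

/-- (cb)(s)(cb)(t)⁻¹ is the product of c(s)c(t)⁻¹ and the conjugate by c(t) of b(s)b(t)⁻¹. Both
factors pass through 1 at s = t, so their velocities add. -/
theorem logDeriv_mul (c b : Curve I G) (t : ℝ) :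
    logDeriv (c * b) t = logDeriv c t + adL I (c t) (logDeriv b t) := by
  have d1 : HasDerivAt (fun s => chartConjBy I (c t) (localCurve b t s))
      (adL I (c t) (logDeriv b t)) t := by
    have := hasFDerivAt_chartConjBy I (c t)
    rw [← localCurve_self b t] at this
    exact this.comp_hasDerivAt t (hasDerivAt_localCurve b t)
  have d2 := (hasDerivAt_localCurve c t).prodMk d1
  have d3 : HasFDerivAt (chartMul I G)
      (fderiv ℝ (chartMul I G) (chartOne I G, chartOne I G))
      (localCurve c t t, chartConjBy I (c t) (localCurve b t t)) := by
    rw [localCurve_self, localCurve_self, chartConjBy_chartOne]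
    exact ((contDiffAt_chartMul I G).differentiableAt (by simp)).hasFDerivAt
  have d4 := (d3.comp_hasDerivAt t d2).deriv
  rw [fderiv_chartMul_apply] at d4
  rw [← d4, logDeriv_eq_deriv]
  refine Filter.EventuallyEq.deriv_eq ?_
  have hs : ∀ᶠ s in nhds t, c t * (b s * (b t)⁻¹) * (c t)⁻¹ ∈ (extChartAt I (1 : G)).source :=
    eventually_mem_source I G (((contMDiff_const.mul (contMDiff_translate b t)).mul
      contMDiff_const).continuous.continuousAt) (by simp)
  filter_upwards [eventually_translate_mem_source c t, eventually_translate_mem_source b t, hs]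
    with s h1 h2 h3
  simp only [Function.comp_apply, chartConjBy, localCurve]
  rw [(extChartAt I (1 : G)).left_inv h2, chartMul, chartLift_apply I _ h1 h3]
  congr 1
  change c s * b s * (c t * b t)⁻¹ = _
  group

theorem logDeriv_one (t : ℝ) : logDeriv (1 : Curve I G) t = 0 := by
  rw [logDeriv_eq_deriv]
  exact (hasDerivAt_const t (extChartAt I (1 : G) (1 * 1⁻¹))).deriv

theorem logDeriv_inv (c : Curve I G) (t : ℝ) :
    logDeriv c⁻¹ t = -adL I (c t)⁻¹ (logDeriv c t) := by
  have h := logDeriv_mul c⁻¹ c t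
  rw [inv_mul_cancel, logDeriv_one] at h
  exact eq_neg_of_add_eq_zero_left h.symm

/-- The derivative of `Ad_{c⁻¹} v` along a curve `c`. -/
theorem hasDerivAt_adL_inv (c : Curve I G) {v : ℝ → E} {v' : E} {t₀ : ℝ}
    (hv : HasDerivAt v v' t₀) :
    HasDerivAt (fun t => adL I (c t)⁻¹ (v t))
      (adL I (c t₀)⁻¹ (v' - bracketL I G (logDeriv c t₀) (v t₀))) t₀ := by
  -- Applied to c⁻¹, the rule for Ad yields differentiability. The value is then read off by
  -- applying Ad_c, which recovers `v`, and using uniqueness of derivatives.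
  have d1 := hasDerivAt_adL c⁻¹ hv
  have d2 := hasDerivAt_adL c d1
  have e : (fun t => adL I (c t) (adL I ((c⁻¹ : Curve I G) t) (v t))) = v := by
    funext t
    exact adL_apply_inv I (c t) (v t)
  rw [e] at d2
  have h := d2.unique hv
  rw [show adL I (c t₀) (adL I ((c⁻¹ : Curve I G) t₀) (v t₀)) = v t₀ from
    adL_apply_inv I (c t₀) (v t₀)] at h
  rw [← h, add_sub_cancel_left, adL_inv_apply]
  exact d1

theorem logDeriv_mul_const (c : Curve I G) (g : G) (t : ℝ) :
    logDeriv (c * ContMDiffMap.const g : Curve I G) t = logDeriv c t := by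
  rw [logDeriv_eq_deriv, logDeriv_eq_deriv]
  congr 1
  funext s
  rw [localCurve, localCurve]
  congr 1
  change c s * g * (c t * g)⁻¹ = _
  group

/-! ### Jets of curves and of their logarithmic derivatives -/

/-- Multiplying by constant curves respects jets, so the comparison can be moved between the chart
around c(0) and the chart around 1. -/
theorem sameJet_iff_localCurve (k : ℕ) (c b : Curve I G) :
    SameJet k c b ↔ c 0 = b 0 ∧
      ∀ n ≤ k, iteratedDeriv n (localCurve c 0) 0 = iteratedDeriv n (localCurve b 0) 0 := by
  refine and_congr_right_iff.2 fun h0 => ?_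
  have hc (d : Curve I G) (hd : d 0 = c 0) :
      ((d * ContMDiffMap.const (c 0)⁻¹ : Curve I G)) 0 = 1 := by
    change d 0 * (c 0)⁻¹ = 1
    rw [hd, mul_inv_cancel]
  have hloc (d : Curve I G) (hd : d 0 = c 0) : extChartAt I (1 : G) ∘
      (d * ContMDiffMap.const (c 0)⁻¹ : Curve I G) = localCurve d 0 := by
    funext t
    rw [localCurve, hd]
    rfl
  constructor
  · intro h
    have := SameJet.mul (k := k) (c := c) (c' := b) ⟨h0, h⟩
      (b := ContMDiffMap.const (c 0)⁻¹) ((jetCon I G k).refl _)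
    have h2 := this.2
    rw [hc c rfl, hloc c rfl, hloc b h0.symm] at h2
    exact h2
  · intro h
    have h2 : SameJet k (c * ContMDiffMap.const (c 0)⁻¹ : Curve I G)
        (b * ContMDiffMap.const (c 0)⁻¹ : Curve I G) := by
      refine ⟨by rw [hc c rfl, hc b h0.symm], ?_⟩
      rw [hc c rfl, hloc c rfl, hloc b h0.symm]
      exact h
    have := SameJet.mul h2 (b := ContMDiffMap.const (c 0)) ((jetCon I G k).refl _)
    have e (d : Curve I G) : (d * ContMDiffMap.const (c 0)⁻¹ * ContMDiffMap.const (c 0) :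
        Curve I G) = d := by
      ext t
      exact inv_mul_cancel_right (d t) (c 0)
    rw [e, e] at this
    exact this.2

theorem sameJet_iff_logDeriv (k : ℕ) (c b : Curve I G) :
    SameJet k c b ↔ c 0 = b 0 ∧
      ∀ n < k, iteratedDeriv n (logDeriv c) 0 = iteratedDeriv n (logDeriv b) 0 := by
  rw [sameJet_iff_localCurve, iteratedDeriv_eq_iff_logDeriv (A := chartTriv I G)
    (by rw [localCurve_self]; exact contDiffAt_chartTriv)
    (by rw [localCurve_self]; exact chartTriv_chartOne)
    (contDiffAt_localCurve c 0) (contDiffAt_localCurve b 0)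
    (by rw [localCurve_self, localCurve_self])]
  have (d : Curve I G) (n : ℕ) := Filter.EventuallyEq.iteratedDeriv_eq n
    (eventually_logDeriv_eq d 0)
  simp only [this]

/-- A smooth curve in the chart through the neutral element is the germ of a smooth curve in the
group. -/
theorem exists_curve_of_chart {u : ℝ → E} (hu : ContDiff ℝ ∞ u) (hu0 : u 0 = chartOne I G) :
    ∃ c : Curve I G, c 0 = 1 ∧ localCurve c 0 =ᶠ[nhds 0] u := by
  have hm : ∀ᶠ t in nhds (0 : ℝ), u t ∈ (extChartAt I (1 : G)).target :=
    hu.continuous.continuousAt.eventually (by rw [hu0]; exact eventually_mem_target I G)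
  obtain ⟨ε, hε, hball⟩ := Metric.eventually_nhds_iff_ball.1 hm
  -- The reparametrization ρ(t) = χ(t)t is the identity near 0 and stays in the ball that `u` maps
  -- into the chart target; so u ∘ ρ defines a curve for all times.
  let χ : ContDiffBump (0 : ℝ) := ⟨ε / 2, ε, by positivity, by linarith⟩
  let ρ : ℝ → ℝ := fun t => χ t * t
  have hρ : ContDiff ℝ ∞ ρ := χ.contDiff.mul contDiff_id
  have hρball : ∀ t, ρ t ∈ Metric.ball (0 : ℝ) ε := by
    intro t
    rw [mem_ball_zero_iff, Real.norm_eq_abs]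
    by_cases ht : |t| < ε
    · calc |ρ t| = |χ t| * |t| := abs_mul _ _
        _ ≤ 1 * |t| := by
          gcongr
          rw [abs_of_nonneg χ.nonneg]
          exact χ.le_one
        _ < ε := by rwa [one_mul]
    · have : χ t = 0 := χ.zero_of_le_dist (by
        rw [Real.dist_0_eq_abs]
        exact not_lt.1 ht)
      simp [ρ, this, hε]
  have hρ1 : ρ =ᶠ[nhds 0] id := by
    filter_upwards [χ.eventuallyEq_one] with t ht
    simp [ρ, ht]
  have hsm : ContMDiff 𝓘(ℝ, ℝ) I ∞ fun t => (extChartAt I (1 : G)).symm (u (ρ t)) :=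
    ((contMDiffOn_extChartAt_symm (1 : G)).comp_contMDiff (hu.comp hρ).contMDiff
      fun t => hball _ (hρball t))
  let c : Curve I G := ⟨_, hsm⟩
  have hc (t : ℝ) : c t = (extChartAt I (1 : G)).symm (u (ρ t)) := rfl
  have hc0 : c 0 = 1 := by
    rw [hc, show ρ 0 = 0 by simp [ρ], hu0, symm_chartOne]
  refine ⟨c, hc0, ?_⟩
  filter_upwards [hρ1, hm] with t h1 h2
  rw [localCurve, hc0, inv_one, mul_one, hc, h1, id, (extChartAt I (1 : G)).right_inv h2]

/-- The jet of the right logarithmic derivative of a curve can be prescribed. -/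
theorem exists_curve_logDeriv (g : G) (x : ℕ → E) (k : ℕ) :
    ∃ c : Curve I G, c 0 = g ∧ ∀ n < k, iteratedDeriv n (logDeriv c) 0 = x n := by
  obtain ⟨u, hu, hu0, h⟩ := exists_logDeriv_eq (contDiffAt_chartTriv (I := I) (G := G))
    chartTriv_chartOne x k
  obtain ⟨c, hc0, hcu⟩ := exists_curve_of_chart hu hu0
  -- Right translation moves the starting point to `g` and leaves the logarithmic derivative
  -- unchanged.
  refine ⟨c * ContMDiffMap.const g, ?_, fun n hn => ?_⟩
  · change c 0 * g = g
    rw [hc0, one_mul]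
  · have e : logDeriv (c * ContMDiffMap.const g : Curve I G) = logDeriv c :=
      funext fun t => logDeriv_mul_const c g t
    rw [e, ← h n hn]
    refine Filter.EventuallyEq.iteratedDeriv_eq n ?_
    filter_upwards [eventually_logDeriv_eq c 0, hcu.eventuallyEq_nhds] with t h1 h2
    rw [h1, h2.deriv_eq, h2.eq_of_nhds]

end

/-! ### Higher derivatives of the logarithmic derivatives of products and inverses -/

noncomputable section

section Terms

variable {E : Type*} [NormedAddCommGroup E] [NormedSpace ℝ E]

/-- The composite `B(X^{(i_ℓ - 1)}) ⋯ B(X^{(i_1 - 1)}) v` at time `t`. -/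
def leftTerm (B : E →L[ℝ] E →L[ℝ] E) (X : ℝ → E) (t : ℝ) (L : List ℕ) (v : E) : E :=
  L.foldl (fun v j => B (iteratedDeriv (j - 1) X t) v) v

/-- The composite `B(X^{(i_1 - 1)}) ⋯ B(X^{(i_ℓ - 1)}) v` at time `t`. -/
def rightTerm (B : E →L[ℝ] E →L[ℝ] E) (X : ℝ → E) (t : ℝ) (L : List ℕ) (v : E) : E :=
  L.foldr (fun j v => B (iteratedDeriv (j - 1) X t) v) v

variable {B : E →L[ℝ] E →L[ℝ] E} {X : ℝ → E} {t : ℝ}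

theorem leftTerm_append (L : List ℕ) (j : ℕ) (v : E) :
    leftTerm B X t (L ++ [j]) v = B (iteratedDeriv (j - 1) X t) (leftTerm B X t L v) := by
  simp [leftTerm]

theorem rightTerm_cons (L : List ℕ) (j : ℕ) (v : E) :
    rightTerm B X t (j :: L) v = B (iteratedDeriv (j - 1) X t) (rightTerm B X t L v) := rfl

theorem leftTerm_add (L : List ℕ) (v w : E) :
    leftTerm B X t L (v + w) = leftTerm B X t L v + leftTerm B X t L w := by
  induction L using List.reverseRecOn with
  | nil => rfl
  | append_singleton L j ih => simp only [leftTerm_append, ih, map_add]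

theorem hasDerivAt_iteratedDeriv (hX : ContDiff ℝ ∞ X) (n : ℕ) (t : ℝ) :
    HasDerivAt (iteratedDeriv n X) (iteratedDeriv (n + 1) X t) t := by
  rw [iteratedDeriv_succ]
  exact (hX.differentiable_iteratedDeriv n (by exact_mod_cast WithTop.coe_lt_top n) t).hasDerivAt

theorem hasDerivAt_iteratedDeriv_pred (hX : ContDiff ℝ ∞ X) {j : ℕ} (hj : 0 < j) (t : ℝ) :
    HasDerivAt (iteratedDeriv (j - 1) X) (iteratedDeriv (j + 1 - 1) X t) t := by
  have := hasDerivAt_iteratedDeriv hX (j - 1) t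
  rwa [Nat.sub_add_cancel hj] at this

theorem modify_append_of_lt {L : List ℕ} {r : ℕ} (hr : r < L.length) (f : ℕ → ℕ)
    (M : List ℕ) : (L ++ M).modify r f = L.modify r f ++ M := by
  rw [List.modify_eq_set_getElem?, List.modify_eq_set_getElem?]
  simp [List.getElem?_append_left hr, hr]

theorem modify_append_length (L : List ℕ) (a : ℕ) (f : ℕ → ℕ) :
    (L ++ [a]).modify L.length f = L ++ [f a] := by
  rw [List.modify_eq_set_getElem?]
  simp

/-- Product rule: the factor labelled j carries X^{(j-1)}, so differentiating it raises its label by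
1. Positivity of the labels keeps j - 1 from being truncated. -/
theorem hasDerivAt_leftTerm (hX : ContDiff ℝ ∞ X) {L : List ℕ} (hL : ∀ j ∈ L, 0 < j) {V : ℝ → E}
    {V' : E} (hV : HasDerivAt V V' t) :
    HasDerivAt (fun t => leftTerm B X t L (V t)) (leftTerm B X t L V' +
      ∑ r ∈ Finset.range L.length, leftTerm B X t (L.modify r (· + 1)) (V t)) t := by
  induction L using List.reverseRecOn with
  | nil => simpa [leftTerm] using hV
  | append_singleton L j ih =>
    have h := ih fun i hi => hL i (by simp [hi])
    have d := B.hasDerivAt_of_bilinear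
      (fun _ => hasDerivAt_iteratedDeriv_pred hX (hL j (by simp)) t) fun _ => h
    simp only [leftTerm_append]
    convert d using 1
    rw [List.length_append, List.length_singleton, Finset.sum_range_succ,
      modify_append_length, leftTerm_append, map_add, map_sum, ← add_assoc]
    congr 2
    refine Finset.sum_congr rfl fun r hr => ?_
    rw [modify_append_of_lt (Finset.mem_range.1 hr), leftTerm_append]

theorem hasDerivAt_rightTerm (hX : ContDiff ℝ ∞ X) {L : List ℕ} (hL : ∀ j ∈ L, 0 < j) {V : ℝ → E}
    {V' : E} (hV : HasDerivAt V V' t) :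
    HasDerivAt (fun t => rightTerm B X t L (V t)) (rightTerm B X t L V' +
      ∑ r ∈ Finset.range L.length, rightTerm B X t (L.modify r (· + 1)) (V t)) t := by
  induction L with
  | nil => simpa [rightTerm] using hV
  | cons j L ih =>
    have h := ih fun i hi => hL i (by simp [hi])
    have d := B.hasDerivAt_of_bilinear
      (fun _ => hasDerivAt_iteratedDeriv_pred hX (hL j (by simp)) t) fun _ => h
    simp only [rightTerm_cons]
    convert d using 1
    rw [List.length_cons, Finset.sum_range_succ', map_add, map_sum, ← add_assoc]
    rfl

/-- If the derivative of each `T L` is given by the sum over all extensions of `L`, then the higher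
derivatives are given by sums over partitions. -/
theorem iteratedDeriv_eq_sum_blockSizes {T : List ℕ → ℝ → E}
    (hT : ∀ L, L ≠ [] → (∀ j ∈ L, 0 < j) → ∀ t,
      HasDerivAt (T L) (sumExtend (fun M => T M t) L) t) (n : ℕ) :
    iteratedDeriv n (T [1]) = fun t => ∑ p : OrderedFinpartition (n + 1), T (blockSizes p) t := by
  induction n with
  | zero =>
    funext t
    -- The one-element set has a single partition, obtained by extending the empty one; its block
    -- sizes are `[1]`.
    rw [iteratedDeriv_zero, sum_blockSizes_succ fun L => T L t, Fintype.sum_unique]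
    have : blockSizes (default : OrderedFinpartition 0) = [] :=
      List.eq_nil_of_length_eq_zero (by simp [blockSizes_length, default])
    rw [this]
    simp [sumExtend]
  | succ n ih =>
    funext t
    rw [iteratedDeriv_succ, ih, sum_blockSizes_succ fun L => T L t]
    refine (HasDerivAt.fun_sum fun p _ => hT (blockSizes p) ?_
      (fun j hj => blockSizes_pos p hj) t).deriv
    intro h
    have := blockSizes_sum p
    simp [h] at this

end Terms

variable {E : Type*} [NormedAddCommGroup E] [NormedSpace ℝ E]
  {H : Type*} [TopologicalSpace H] {I : ModelWithCorners ℝ E H}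
  {G : Type*} [TopologicalSpace G] [ChartedSpace H G] [Group G]
  [I.Boundaryless] [LieGroup I ∞ G]

/-- The summands of the derivatives of `Ad_c δʳb`. -/
def mulCurveTerm (c b : Curve I G) (L : List ℕ) (t : ℝ) : E :=
  leftTerm (bracketL I G) (logDeriv c) t L.dropLast
    (adL I (c t) (iteratedDeriv (L.getLastD 0 - 1) (logDeriv b) t))

/-- The summands of the derivatives of `-Ad_{c⁻¹} δʳc`. -/
def invCurveTerm (c : Curve I G) (L : List ℕ) (t : ℝ) : E :=
  (-1 : ℝ) ^ L.length • adL I (c t)⁻¹ (rightTerm (bracketL I G) (logDeriv c) t L.dropLast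
    (iteratedDeriv (L.getLastD 0 - 1) (logDeriv c) t))

theorem mulCurveTerm_append (c b : Curve I G) (L : List ℕ) (a : ℕ) (t : ℝ) :
    mulCurveTerm c b (L ++ [a]) t = leftTerm (bracketL I G) (logDeriv c) t L
      (adL I (c t) (iteratedDeriv (a - 1) (logDeriv b) t)) := by
  simp [mulCurveTerm, List.getLastD_eq_getLast?]

theorem invCurveTerm_append (c : Curve I G) (L : List ℕ) (a : ℕ) (t : ℝ) :
    invCurveTerm c (L ++ [a]) t = (-1 : ℝ) ^ (L.length + 1) • adL I (c t)⁻¹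
      (rightTerm (bracketL I G) (logDeriv c) t L (iteratedDeriv (a - 1) (logDeriv c) t)) := by
  simp [invCurveTerm, List.getLastD_eq_getLast?]

/-- Differentiating Ad_c puts a new ad_{δʳc} innermost, at the head of the list since `foldl`
applies the head first. Every other factor only has its label raised. -/
theorem hasDerivAt_mulCurveTerm (c b : Curve I G) {L : List ℕ} (hne : L ≠ [])
    (hL : ∀ j ∈ L, 0 < j) (t : ℝ) :
    HasDerivAt (mulCurveTerm c b L) (sumExtend (fun M => mulCurveTerm c b M t) L) t := by
  obtain ⟨M, a, rfl⟩ : ∃ M a, L = M ++ [a] := ⟨_, _, (List.dropLast_append_getLast hne).symm⟩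
  have d := hasDerivAt_leftTerm (B := bracketL I G) (contDiff_logDeriv c)
    (fun j hj => hL j (by simp [hj]))
    (hasDerivAt_adL c (hasDerivAt_iteratedDeriv_pred (contDiff_logDeriv b) (hL a (by simp)) t))
    (L := M)
  have e : mulCurveTerm c b (M ++ [a]) = _ := funext fun t => mulCurveTerm_append c b M a t
  rw [e]
  convert d using 1
  rw [sumExtend, ← List.cons_append, mulCurveTerm_append, List.length_append,
    List.length_singleton, Finset.sum_range_succ, modify_append_length, mulCurveTerm_append,
    leftTerm_add, add_assoc]
  congr 1
  rw [add_comm]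
  congr 1
  refine Finset.sum_congr rfl fun r hr => ?_
  rw [modify_append_of_lt (Finset.mem_range.1 hr), mulCurveTerm_append]

/-- Differentiating Ad_{c⁻¹} puts a new -ad_{δʳc} outermost, which is the head of the list for
`foldr`. The minus sign matches the longer list. -/
theorem hasDerivAt_invCurveTerm (c : Curve I G) {L : List ℕ} (hne : L ≠ [])
    (hL : ∀ j ∈ L, 0 < j) (t : ℝ) :
    HasDerivAt (invCurveTerm c L) (sumExtend (fun M => invCurveTerm c M t) L) t := by
  obtain ⟨M, a, rfl⟩ : ∃ M a, L = M ++ [a] := ⟨_, _, (List.dropLast_append_getLast hne).symm⟩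
  have d := (hasDerivAt_adL_inv c (hasDerivAt_rightTerm (B := bracketL I G) (contDiff_logDeriv c)
    (fun j hj => hL j (by simp [hj]))
    (hasDerivAt_iteratedDeriv_pred (contDiff_logDeriv c) (hL a (by simp)) t)
    (L := M))).const_smul ((-1 : ℝ) ^ (M.length + 1))
  have e : invCurveTerm c (M ++ [a]) = _ := funext fun t => invCurveTerm_append c M a t
  rw [e]
  refine d.congr_deriv (Eq.symm ?_)
  rw [sumExtend, ← List.cons_append, invCurveTerm_append, List.length_append,
    List.length_singleton, Finset.sum_range_succ, modify_append_length, invCurveTerm_append,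
    map_sub, map_add, map_sum, smul_sub, smul_add, Finset.smul_sum, List.length_cons,
    rightTerm_cons, pow_succ _ (M.length + 1), sub_eq_neg_add, add_comm (Finset.sum _ _)]
  congr 1
  · simp
  · congr 1
    refine Finset.sum_congr rfl fun r hr => ?_
    rw [modify_append_of_lt (Finset.mem_range.1 hr), invCurveTerm_append, List.length_modify]

theorem iteratedDeriv_logDeriv_mul (c b : Curve I G) (n : ℕ) (t : ℝ) :
    iteratedDeriv n (logDeriv (c * b)) t = iteratedDeriv n (logDeriv c) t +
      ∑ p : OrderedFinpartition (n + 1), mulCurveTerm c b (blockSizes p) t := by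
  have h := congrFun (iteratedDeriv_eq_sum_blockSizes
    (fun L hne hL t => hasDerivAt_mulCurveTerm c b hne hL t) n) t
  -- The term of `[1]` is Ad_c δʳb, which is what remains of δʳ(cb) after δʳc is removed.
  have e : mulCurveTerm c b [1] = logDeriv (c * b) - logDeriv c := by
    funext t
    simp [mulCurveTerm, leftTerm, logDeriv_mul]
  have le : (n : WithTop ℕ∞) ≤ ∞ := by exact_mod_cast le_top
  rw [e, iteratedDeriv_sub ((contDiff_logDeriv _).contDiffAt.of_le le)
    ((contDiff_logDeriv _).contDiffAt.of_le le), sub_eq_iff_eq_add'] at h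
  exact h

theorem iteratedDeriv_logDeriv_inv (c : Curve I G) (n : ℕ) (t : ℝ) :
    iteratedDeriv n (logDeriv c⁻¹) t =
      ∑ p : OrderedFinpartition (n + 1), invCurveTerm c (blockSizes p) t := by
  have h := congrFun (iteratedDeriv_eq_sum_blockSizes
    (fun L hne hL t => hasDerivAt_invCurveTerm c hne hL t) n) t
  have e : invCurveTerm c [1] = logDeriv c⁻¹ := by
    funext t
    simp [invCurveTerm, rightTerm, logDeriv_inv]
  rwa [e] at h

/-! ### The right trivialization -/

theorem rightCoords_eq_iff (k : ℕ) (c b : Curve I G) :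
    rightCoords k c = rightCoords k b ↔ SameJet k c b := by
  rw [sameJet_iff_logDeriv]
  refine Prod.ext_iff.trans (and_congr_right fun _ => ⟨fun h n hn => ?_, fun h => ?_⟩)
  · exact congrFun h ⟨n + 1, Finset.mem_Icc.2 ⟨by omega, hn⟩⟩
  · funext n
    have := Finset.mem_Icc.1 n.2
    exact h (n - 1) (by omega)

variable (I G) in
/-- The right trivialization of the jet group. -/
def rightTrivialization (k : ℕ) : Jet I G k ≃ G × (Finset.Icc 1 k → GroupLieAlgebra I G) :=
  Equiv.ofBijective
    (fun j => Con.liftOn j (rightCoords k) fun c b h => (rightCoords_eq_iff k c b).2 h) <| by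
    constructor
    · intro a b
      induction a using Con.induction_on with | _ c
      induction b using Con.induction_on with | _ b
      intro h
      exact (jet_eq_iff k c b).2 ((rightCoords_eq_iff k c b).1 h)
    · rintro ⟨g, x⟩
      -- The shift by one reflects that the component with index j is the derivative of order j - 1.
      obtain ⟨c, hc0, hc⟩ := exists_curve_logDeriv (I := I) g (fun n => entry x (n + 1)) k
      refine ⟨jet k c, Prod.ext hc0 ?_⟩
      funext n
      have hn := Finset.mem_Icc.1 n.2
      refine (hc (n - 1) (by omega)).trans ?_
      have e : (n : ℕ) - 1 + 1 = n := by omega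
      simp only [e]
      exact dif_pos n.2

theorem rightTrivialization_jet (k : ℕ) (c : Curve I G) :
    rightTrivialization I G k (jet k c) = rightCoords k c := rfl

theorem entry_rightCoords {k : ℕ} (c : Curve I G) {j : ℕ} (h1 : 0 < j) (hk : j ≤ k) :
    entry (rightCoords k c).2 j = iteratedDeriv (j - 1) (logDeriv c) 0 :=
  dif_pos (Finset.mem_Icc.2 ⟨h1, hk⟩)

variable [CompleteSpace E]

/-- The bounds on the labels, satisfied by block sizes, ensure that the default value 0 of `entry`
never occurs. -/
theorem foldl_bracket {k : ℕ} (c : Curve I G) {L : List ℕ} (h : ∀ j ∈ L, 0 < j ∧ j ≤ k)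
    (v : GroupLieAlgebra I G) :
    L.foldl (fun v j => ⁅entry (rightCoords k c).2 j, v⁆) v =
      leftTerm (bracketL I G) (logDeriv c) 0 L v := by
  induction L generalizing v with
  | nil => rfl
  | cons j L ih =>
    have hj := h j (by simp)
    rw [List.foldl_cons, ih (fun i hi => h i (by simp [hi])), bracket_eq,
      entry_rightCoords c hj.1 hj.2]
    rfl

theorem foldr_bracket {k : ℕ} (c : Curve I G) {L : List ℕ} (h : ∀ j ∈ L, 0 < j ∧ j ≤ k)
    (v : GroupLieAlgebra I G) :
    L.foldr (fun j v => ⁅entry (rightCoords k c).2 j, v⁆) v =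
      rightTerm (bracketL I G) (logDeriv c) 0 L v := by
  induction L with
  | nil => rfl
  | cons j L ih =>
    have hj := h j (by simp)
    exact (bracket_eq I _ _).trans (congrArg₂ (fun a b => bracketL I G a b)
      (entry_rightCoords c hj.1 hj.2) (ih fun i hi => h i (by simp [hi])))

theorem getLastD_mem {L : List ℕ} (hne : L ≠ []) : L.getLastD 0 ∈ L := by
  rw [List.getLastD_eq_getLast?, List.getLast?_eq_some_getLast hne]
  exact List.getLast_mem hne

theorem mulTerm_rightCoords {k : ℕ} (c b : Curve I G) {L : List ℕ} (hne : L ≠ [])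
    (h : ∀ j ∈ L, 0 < j ∧ j ≤ k) :
    mulTerm (c 0) (rightCoords k c).2 (rightCoords k b).2 L = mulCurveTerm c b L 0 := by
  have hl := h _ (getLastD_mem hne)
  rw [mulTerm, foldl_bracket c fun j hj => h j (List.mem_of_mem_dropLast hj), Ad_eq_adL,
    entry_rightCoords b hl.1 hl.2]
  rfl

theorem invTerm_rightCoords {k : ℕ} (c : Curve I G) {L : List ℕ} (hne : L ≠ [])
    (h : ∀ j ∈ L, 0 < j ∧ j ≤ k) :
    (-1 : ℝ) ^ L.length • invTerm (c 0) (rightCoords k c).2 L = invCurveTerm c L 0 := by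
  have hl := h _ (getLastD_mem hne)
  refine congrArg (fun v : E => (-1 : ℝ) ^ L.length • v) ((Ad_eq_adL I _ _).trans ?_)
  exact congrArg (adL I (c 0)⁻¹) ((foldr_bracket c
    (fun j hj => h j (List.mem_of_mem_dropLast hj)) _).trans
      (congrArg (rightTerm (bracketL I G) (logDeriv c) 0 L.dropLast)
        (entry_rightCoords c hl.1 hl.2)))

theorem blockSizes_ne_nil {n : ℕ} (hn : 1 ≤ n) (p : OrderedFinpartition n) :
    blockSizes p ≠ [] := by
  intro h
  have := blockSizes_sum p
  simp only [h, List.sum_nil] at this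
  omega

theorem rightCoords_mul {k : ℕ} (c b : Curve I G) (n : Finset.Icc 1 k) :
    (rightCoords k (c * b)).2 n = (rightCoords k c).2 n + ∑ p : OrderedFinpartition n,
      mulTerm (c 0) (rightCoords k c).2 (rightCoords k b).2 (blockSizes p) := by
  obtain ⟨n, hn⟩ := n
  have hn' := Finset.mem_Icc.1 hn
  obtain ⟨m, rfl⟩ : ∃ m, n = m + 1 := ⟨n - 1, by omega⟩
  refine (iteratedDeriv_logDeriv_mul c b m 0).trans ?_
  refine congrArg₂ (· + ·) rfl (Finset.sum_congr rfl fun p _ => ?_)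
  exact (mulTerm_rightCoords c b (blockSizes_ne_nil hn'.1 p) fun j hj =>
    ⟨blockSizes_pos p hj, (blockSizes_le p hj).trans hn'.2⟩).symm

theorem rightCoords_inv {k : ℕ} (c : Curve I G) (n : Finset.Icc 1 k) :
    (rightCoords k c⁻¹).2 n = ∑ p : OrderedFinpartition n,
      (-1 : ℝ) ^ p.length • invTerm (c 0) (rightCoords k c).2 (blockSizes p) := by
  obtain ⟨n, hn⟩ := n
  have hn' := Finset.mem_Icc.1 hn
  obtain ⟨m, rfl⟩ : ∃ m, n = m + 1 := ⟨n - 1, by omega⟩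
  refine (iteratedDeriv_logDeriv_inv c m 0).trans (Finset.sum_congr rfl fun p _ => ?_)
  rw [← blockSizes_length]
  exact (invTerm_rightCoords c (blockSizes_ne_nil hn'.1 p) fun j hj =>
    ⟨blockSizes_pos p hj, (blockSizes_le p hj).trans hn'.2⟩).symm

end

end JetGroup

/-! ### The product and inverse formulas on the jet group -/

theorem theorem2p6
    {E : Type*} [NormedAddCommGroup E] [NormedSpace ℝ E] [CompleteSpace E]
    {H : Type*} [TopologicalSpace H] (I : ModelWithCorners ℝ E H) [I.Boundaryless]
    (G : Type*) [TopologicalSpace G] [ChartedSpace H G] [Group G] [LieGroup I ∞ G] (k : ℕ) :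
    -- the right trivialization is a well-defined bijection
    ∃ Φ : JetGroup.Jet I G k ≃ G × (Finset.Icc 1 k → GroupLieAlgebra I G),
      (∀ c : JetGroup.Curve I G, Φ (JetGroup.jet k c) = JetGroup.rightCoords k c) ∧
      -- the product
      (∀ (g h : G) (x y : Finset.Icc 1 k → GroupLieAlgebra I G),
        ∃ z : Finset.Icc 1 k → GroupLieAlgebra I G,
          Φ (Φ.symm (g, x) * Φ.symm (h, y)) = (g * h, z) ∧
          ∀ n : Finset.Icc 1 k,
            z n = x n + ∑ p : OrderedFinpartition n,
              JetGroup.mulTerm g x y (JetGroup.blockSizes p) ∧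
            z n = x n + ∑ l ∈ Finset.Icc 1 (n : ℕ), ∑ i : Composition n with i.length = l,
              JetGroup.N i • JetGroup.mulTerm g x y i.blocks) ∧
      -- the inverse
      (∀ (g : G) (x : Finset.Icc 1 k → GroupLieAlgebra I G),
        ∃ w : Finset.Icc 1 k → GroupLieAlgebra I G,
          Φ (Φ.symm (g, x))⁻¹ = (g⁻¹, w) ∧
          ∀ n : Finset.Icc 1 k,
            w n = ∑ p : OrderedFinpartition n,
              (-1 : ℝ) ^ p.length • JetGroup.invTerm g x (JetGroup.blockSizes p) ∧
            w n = ∑ l ∈ Finset.Icc 1 (n : ℕ), ∑ i : Composition n with i.length = l,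
              (-1 : ℝ) ^ l • JetGroup.N i • JetGroup.invTerm g x i.blocks) := by
  -- Every coordinate tuple comes from a curve, so the formulas need only be checked on coordinates
  -- of curves.
  have hsurj : ∀ (g : G) (x : Finset.Icc 1 k → GroupLieAlgebra I G), ∃ c : JetGroup.Curve I G,
      (JetGroup.rightTrivialization I G k).symm (g, x) = JetGroup.jet k c ∧ c 0 = g ∧
        (JetGroup.rightCoords k c).2 = x := by
    intro g x
    obtain ⟨c, hc⟩ := Con.mk'_surjective ((JetGroup.rightTrivialization I G k).symm (g, x))
    have h := congrArg (JetGroup.rightTrivialization I G k) hc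
    rw [Equiv.apply_symm_apply] at h
    exact ⟨c, hc.symm, congrArg Prod.fst h, congrArg Prod.snd h⟩
  refine ⟨JetGroup.rightTrivialization I G k, JetGroup.rightTrivialization_jet k, ?_, ?_⟩
  · intro g h x y
    obtain ⟨c, hc, rfl, rfl⟩ := hsurj g x
    obtain ⟨b, hb, rfl, rfl⟩ := hsurj h y
    refine ⟨(JetGroup.rightCoords k (c * b)).2, ?_, fun n => ?_⟩
    · rw [hc, hb]
      rfl
    · have hn := Finset.mem_Icc.1 n.2
      rw [← JetGroup.sum_blockSizes_eq_sum_composition _ hn.1]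
      exact ⟨JetGroup.rightCoords_mul c b n, JetGroup.rightCoords_mul c b n⟩
  · intro g x
    obtain ⟨c, hc, rfl, rfl⟩ := hsurj g x
    refine ⟨(JetGroup.rightCoords k c⁻¹).2, ?_, fun n => ?_⟩
    · rw [hc]
      rfl
    · have hn := Finset.mem_Icc.1 n.2
      refine ⟨JetGroup.rightCoords_inv c n, ?_⟩
      -- Rewriting the sign in terms of the list itself makes the summand a function of block sizes
      -- alone, as regrouping by compositions requires.
      have e : ∀ l, ∀ i ∈ Finset.univ.filter (fun i : Composition n => i.length = l),
          (-1 : ℝ) ^ l • JetGroup.N i • JetGroup.invTerm (c 0) (JetGroup.rightCoords k c).2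
            i.blocks = JetGroup.N i • ((-1 : ℝ) ^ i.blocks.length •
              JetGroup.invTerm (c 0) (JetGroup.rightCoords k c).2 i.blocks) := by
        intro l i hi
        rw [i.blocks_length, (Finset.mem_filter.1 hi).2, smul_comm]
      rw [Finset.sum_congr rfl fun l _ => Finset.sum_congr rfl (e l),
        ← JetGroup.sum_blockSizes_eq_sum_composition (fun L => (-1 : ℝ) ^ L.length •
          JetGroup.invTerm (c 0) (JetGroup.rightCoords k c).2 L) hn.1]
      simp only [JetGroup.blockSizes_length]
      exact JetGroup.rightCoords_inv c n
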